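/- **Pfaffians.** Let $n\ge 0$, $[2n]=\{1,\dots,2n\}$, and let $A=(a_{ij})$ be a skew-symmetric $2n\times 2n$ matrix over a commutative ring. For a finite totally ordered set $V$ let $F_V$ be the set of perfect matchings of $V$, write $F_{2n}=F_{[2n]}$, and for $\pi\in F_V$ let $a_\pi=\prod_{(i<j)\in\pi}a_{ij}$ and let $\mathrm{cn}(\pi)$ be the number of pairs of edges $(i<j),(k<l)$ of $\pi$ with $i<k<j<l$. For $I\subseteq[2n]$ put $\mathrm{pf}_I(A)=\sum_{\pi\in F_I}(-1)^{\mathrm{cn}(\pi)}a_\pi$, $\bar I=[2n]\setminus I$, and $\mathrm{pf}_{I,\bar I}(A)=\mathrm{pf}_I(A)\,\mathrm{pf}_{\bar I}(A)$. **Diagrams.** Place points $1,\dots,2n$ on the left side and $1',\dots,(2n)'$ on the right side of a rectangle, both numbered from top to bottom. Let $\mathcal T_n$ be the set of symmetric TL-diagrams, that is, non-crossing perfect matchings of these $4n$ points which are invariant under the reflection $i\leftrightarrow i'$ in the vertical axis. For $I\subseteq[2n]$ color the points of $I\cup\{i': i\in\bar I\}$ black and the others white; $D\in\mathcal T_n$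 is *$I$-compatible* if each edge of $D$ has ends of different colors. **Nice embeddings.** For $\pi\in F_{2n}$ let $\nu(\pi)$ be the matching of the $4n$ points which contains $(i,j')$ and $(j,i')$ for each $(i,j)\in\pi$. A *nice embedding* of $\nu(\pi)$ draws every edge in the rectangle as a continuous curve running from left to right (the graph of a function of the horizontal coordinate), so that the drawing is mirror symmetric, every two edges meet at most once, no two edges touch without crossing, and no three edges meet in one point. A crossing of $(i,j')$ with $(j,i')$ is *unpaired*; every other crossing is *paired* with its mirror image. **Weights.** Given a nice embedding of $\nu(\pi)$, let $X(\pi)$ be the set of ways $x$ to uncross every crossing, either *vertically* (joining the two left halves to each other and the two right halves to each other) or *horizontally* (joining the left half of each strand to the right half of the other), where paired crossings are uncrossed in the same way. The resulting drawing consists of an element $D(x)\in\mathcal T_n$ (recording which boundary points are joined) together with closed loops. Put $\mathrm{wt}(x)=2^{l(x)}(-1)^{\mathrm{uv}(x)+\mathrm{ph}(x)}$, where $l(x)$ is the number of closed loops, with two mutually mirror-symmetric loops counted once, $\mathrm{uv}(x)$ is the number of unpaired crossings uncrossed vertically, and $\mathrm{ph}(x)$ is the number of pairs of paired crossings uncrossed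 horizontally. Fixing a nice embedding of $\nu(\pi)$ for each $\pi\in F_{2n}$, define for $D\in\mathcal T_n$ $$f_D(\pi)=\sum_{x\in X(\pi),\ D(x)=D}\mathrm{wt}(x),\qquad \mathrm{Pfaf}'_D(A)=\sum_{\pi\in F_{2n}}f_D(\pi)\,a_\pi .$$ **Theorem.** For every choice of nice embeddings and every subset $I\subseteq[2n]$ of even cardinality, $$\mathrm{pf}_{I,\bar I}(A)=\sum_{D}\mathrm{Pfaf}'_D(A),$$ where the sum is over all $I$-compatible $D\in\mathcal T_n$. -/

import Mathlib

open Set Filter Topology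

noncomputable section

namespace TLPfaff

/-! ### Matchings and pfaffians -/

/-- A (perfect) matching on `V`, given by the map sending each vertex to its partner:
a fixed-point-free involution. -/
abbrev Matching (V : Type*) := {m : V → V // Function.Involutive m ∧ ∀ v, m v ≠ v}

instance (V : Type*) : CoeFun (Matching V) (fun _ => V → V) := ⟨fun m => m.1⟩

instance (V : Type*) [Finite V] : Fintype (Matching V) := Fintype.ofFinite _

/-- The number of crossings of the arc diagram of a matching: with the vertices in order on a
straight line, the arcs `(i, π i)` and `(k, π k)` cross exactly when, up to renaming,
`i < k < π i < π k`. -/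
def crossingNumber {V : Type*} [LinearOrder V] (π : Matching V) : ℕ :=
  Set.ncard {p : V × V | p.1 < p.2 ∧ p.2 < π p.1 ∧ π p.1 < π p.2}

/-- The monomial `a_π = ∏ a i j` over the edges `(i, j)`, `i < j`, of `π`. -/
def monomial {R V : Type*} [CommRing R] [Fintype V] [LinearOrder V]
    (A : Matrix V V R) (π : Matching V) : R :=
  ∏ i : V with i < π i, A i (π i)

/-- The pfaffinant `∑_π f π * a_π`. -/
def pfaffinant {R V : Type*} [CommRing R] [Fintype V] [LinearOrder V]
    (f : Matching V → R) (A : Matrix V V R) : R :=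
  ∑ π : Matching V, f π * monomial A π

/-- The pfaffian `∑_π (-1)^{cn π} * a_π`. -/
def pfaffian {R V : Type*} [CommRing R] [Fintype V] [LinearOrder V] (A : Matrix V V R) : R :=
  ∑ π : Matching V, (-1) ^ crossingNumber π * monomial A π

/-- The pfaffian of the submatrix with rows and columns in `I`. -/
def pfaffianOn {R V : Type*} [CommRing R] [LinearOrder V]
    (I : Finset V) (A : Matrix V V R) : R :=
  pfaffian (A.submatrix (Subtype.val : I → V) (Subtype.val : I → V))

/-- The complementary pfaffian: the product of the pfaffians on `I` and on its complement. -/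
def complementaryPfaffian {R V : Type*} [CommRing R] [Fintype V] [LinearOrder V]
    (I : Finset V) (A : Matrix V V R) : R :=
  pfaffianOn I A * pfaffianOn Iᶜ A

/-! ### Symmetric Temperley-Lieb diagrams -/

/-- The vertices on the two sides of the rectangle: `Sum.inl i` is the vertex `i` on the left
side, `Sum.inr i` is the vertex `i'` on the right side; both sides are numbered from top to
bottom. The mirror image of a vertex is `Sum.swap`. -/
abbrev Vertex (N : ℕ) := Fin N ⊕ Fin N

/-- Position along the boundary of the rectangle, going down the left side and then up the
right side: `1, 2, …, N, N', …, 2', 1'`. -/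
def boundaryPos {N : ℕ} : Vertex N → ℕ
  | Sum.inl i => i
  | Sum.inr i => 2 * N - 1 - i

/-- No two edges cross when drawn inside the rectangle. -/
def IsNoncrossing {N : ℕ} (D : Matching (Vertex N)) : Prop :=
  ¬ ∃ v w : Vertex N, boundaryPos v < boundaryPos w ∧ boundaryPos w < boundaryPos (D v) ∧
    boundaryPos (D v) < boundaryPos (D w)

/-- Symmetry about the vertical axis. -/
def IsMirrorSymmetric {N : ℕ} (D : Matching (Vertex N)) : Prop :=
  ∀ v, D v.swap = (D v).swap

/-- The set `𝒯_n` of symmetric Temperley-Lieb diagrams on `4n` vertices. -/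
abbrev SymTLDiagram (n : ℕ) :=
  {D : Matching (Vertex (2 * n)) // IsNoncrossing D ∧ IsMirrorSymmetric D}

instance (n : ℕ) : Fintype (SymTLDiagram n) := Fintype.ofFinite _

/-- The black vertices of the `I`-coloring: `I` on the left, the complement of `I` on the
right. All other vertices are white. -/
def IsBlack {N : ℕ} (I : Finset (Fin N)) : Vertex N → Prop
  | Sum.inl i => i ∈ I
  | Sum.inr i => i ∉ I

/-- Each edge of `D` has ends of different color in the `I`-coloring. -/
def IsCompatible {N : ℕ} (I : Finset (Fin N)) (D : Matching (Vertex N)) : Prop :=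
  ∀ v, ¬ (IsBlack I v ↔ IsBlack I (D v))

open Classical in
/-- The set `𝒟(I)` of `I`-compatible symmetric Temperley-Lieb diagrams. -/
def compatibleDiagrams {n : ℕ} (I : Finset (Fin (2 * n))) : Finset (SymTLDiagram n) :=
  Finset.univ.filter fun D => IsCompatible I D.1

/-! ### Nice embeddings of `ν(π)` -/

/-- A nice embedding of the matching `ν(π)` of `[N] ∪ [N]'` whose edges are `(i, (π i)')`.

The vertices `i` and `i'` are the points `(-1, height i)` and `(1, height i)`; the edge
`(i, (π i)')` runs from left to right and is the curve `{(x, curve i x) | -1 ≤ x ≤ 1}`. Being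
continuous on a compact interval, all these curves lie in a rectangle `[-1, 1] × [a, b]`.
The reflection in the vertical axis is `(x, y) ↦ (-x, y)`, and the mirror image of the edge
`(i, (π i)')` is the edge `(π i, i')`. -/
structure NiceEmbedding {N : ℕ} (π : Matching (Fin N)) where
  /-- the height of the vertices `i` and `i'` -/
  height : Fin N → ℝ
  /-- the edge from `i` to `(π i)'` -/
  curve : Fin N → ℝ → ℝ
  /-- the vertices are numbered from top to bottom -/
  height_strictAnti : StrictAnti height
  continuousOn_curve : ∀ i, ContinuousOn (curve i) (Icc (-1) 1)
  curve_left : ∀ i, curve i (-1) = height i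
  curve_right : ∀ i, curve i 1 = height (π i)
  /-- every pair of edges intersects at most once -/
  meet_at_most_once : ∀ i j, i ≠ j → ∀ x ∈ Icc (-1 : ℝ) 1, ∀ y ∈ Icc (-1 : ℝ) 1,
    curve i x = curve j x → curve i y = curve j y → x = y
  /-- mirror symmetry -/
  mirror : ∀ i, ∀ x ∈ Icc (-1 : ℝ) 1, curve (π i) (-x) = curve i x
  /-- no point of tangency: where two edges meet, they change sides -/
  no_tangency : ∀ i j, i ≠ j → ∀ x ∈ Icc (-1 : ℝ) 1, curve i x = curve j x →
    ∀ᶠ s in 𝓝[<] x, ∀ᶠ t in 𝓝[>] x, (curve i s - curve j s) * (curve i t - curve j t) < 0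
  /-- no three edges meet at a single point -/
  no_triple : ∀ i j k, i ≠ j → j ≠ k → i ≠ k → ∀ x ∈ Icc (-1 : ℝ) 1,
    ¬ (curve i x = curve j x ∧ curve j x = curve k x)

namespace NiceEmbedding

/-- Nice embeddings exist: straight edges between vertices at generic heights. -/
theorem nonempty {N : ℕ} (π : Matching (Fin N)) : Nonempty (NiceEmbedding π) := by
  classical
  let g : ℕ → ℕ := fun a => 2 ^ (2 ^ a)
  let h : Fin N → ℝ := fun i => -((g i : ℕ) : ℝ)
  have hg : StrictMono g := fun a b hab =>
    Nat.pow_lt_pow_right (by norm_num) (Nat.pow_lt_pow_right (by norm_num) hab)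
  have hh : StrictAnti h := fun i j hij => by
    simp only [h, neg_lt_neg_iff, Nat.cast_lt]
    exact hg hij
  let f : Fin N → ℝ → ℝ := fun i x => ((1 - x) * h i + (1 + x) * h (π i)) / 2
  have hinj := Finset.geomSum_injective (n := 2) le_rfl
  -- two distinct lines do not coincide
  have once : ∀ i j, i ≠ j → ∀ x y, f i x = f j x → f i y = f j y → x = y := by
    intro i j hij x y hx hy
    by_contra hxy
    have hxy' : x - y ≠ 0 := sub_ne_zero.2 hxy
    apply hij
    apply hh.injective
    have : (x - y) * (h i - h j) = 0 := by
      simp only [f] at hx hy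
      linear_combination (-(1 + y)) * hx + (1 + x) * hy
    rcases mul_eq_zero.1 this with h0 | h0
    · exact absurd h0 hxy'
    · linarith
  have hval : ∀ a b c d : Fin N, h a + h b = h c + h d → a ≠ b → c ≠ d →
      a = c ∨ a = d := by
    intro a b c d e hab hcd
    have e' : g a + g b = g c + g d := by
      have : ((g a + g b : ℕ) : ℝ) = ((g c + g d : ℕ) : ℝ) := by
        push_cast; simp only [h] at e; linarith
      exact_mod_cast this
    have e2 := @hinj {2 ^ (a : ℕ), 2 ^ (b : ℕ)} {2 ^ (c : ℕ), 2 ^ (d : ℕ)} (by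
      have hp : ∀ u v : Fin N, u ≠ v → (2 : ℕ) ^ (u : ℕ) ≠ 2 ^ (v : ℕ) := fun u v huv q =>
        huv (Fin.ext (Nat.pow_right_injective le_rfl q))
      simp only [Finset.sum_pair (hp a b hab), Finset.sum_pair (hp c d hcd)]
      exact e')
    have : 2 ^ (a : ℕ) ∈ ({2 ^ (c : ℕ), 2 ^ (d : ℕ)} : Finset ℕ) := by rw [← e2]; simp
    simp only [Finset.mem_insert, Finset.mem_singleton] at this
    rcases this with q | q
    · exact Or.inl (Fin.ext (Nat.pow_right_injective le_rfl q))
    · exact Or.inr (Fin.ext (Nat.pow_right_injective le_rfl q))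
  -- a pair of mirror images and a third line
  have tripleA : ∀ i k, k ≠ i → k ≠ π i → ∀ x, f i x = f (π i) x → f i x = f k x → False := by
    intro i k h1 h2 x e1 e2
    have hx : x = 0 := by
      refine once i (π i) (π.2.2 i).symm x 0 e1 ?_
      simp only [f, π.2.1 i]; ring
    subst hx
    rcases hval k (π k) i (π i) (by simp only [f] at e2; linarith)
      (π.2.2 k).symm (π.2.2 i).symm with q | q
    · exact h1 q
    · exact h2 q
  -- three lines, no two of which are mirror images
  have tripleB : ∀ i j k, i ≠ j → j ≠ k → i ≠ k → j ≠ π i → k ≠ π i → k ≠ π j → ∀ x,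
      f i x = f j x → f j x = f k x → False := by
    intro i j k hij hjk hik hj hk hkj x e1 e2
    have det : h i * h (π j) + h j * h (π k) + h k * h (π i)
        = h i * h (π k) + h j * h (π i) + h k * h (π j) := by
      simp only [f] at e1 e2
      by_cases hx : 1 + x = 0
      · exfalso
        apply hij
        apply hh.injective
        have : x = -1 := by linarith
        subst this
        linarith
      · apply mul_left_cancel₀ hx
        linear_combination (2 * (h k - h j)) * e1 + (2 * (h i - h j)) * e2
    have det' : g i * g (π j) + g j * g (π k) + g k * g (π i)
        = g i * g (π k) + g j * g (π i) + g k * g (π j) := by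
      have : ((g i * g (π j) + g j * g (π k) + g k * g (π i) : ℕ) : ℝ)
          = ((g i * g (π k) + g j * g (π i) + g k * g (π j) : ℕ) : ℝ) := by
        push_cast; simp only [h] at det; linarith
      exact_mod_cast this
    let e : Fin N → Fin N → ℕ := fun a b => 2 ^ (a : ℕ) + 2 ^ (b : ℕ)
    have he : ∀ a b c d : Fin N, a ≠ b → c ≠ d → e a b = e c d →
        (a = c ∨ a = d) ∧ (b = c ∨ b = d) := by
      intro a b c d hab hcd q
      have hab' : (a : ℕ) ≠ b := fun q => hab (Fin.ext q)
      have hcd' : (c : ℕ) ≠ d := fun q => hcd (Fin.ext q)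
      have e2 := @hinj {(a : ℕ), (b : ℕ)} {(c : ℕ), (d : ℕ)} (by
        simp only [Finset.sum_pair hab', Finset.sum_pair hcd']
        exact q)
      have m1 : (a : ℕ) ∈ ({(c : ℕ), (d : ℕ)} : Finset ℕ) := by rw [← e2]; simp
      have m2 : (b : ℕ) ∈ ({(c : ℕ), (d : ℕ)} : Finset ℕ) := by rw [← e2]; simp
      simp only [Finset.mem_insert, Finset.mem_singleton, Fin.val_inj] at m1 m2
      exact ⟨m1, m2⟩
    have hge : ∀ a b, g a * g b = 2 ^ (2 ^ a + 2 ^ b) := fun a b => (pow_add _ _ _).symm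
    have inj : ∀ a b, π a = π b → a = b := fun a b q => π.2.1.injective q
    have inv : ∀ a b, a = π b → b = π a := fun a b q => by rw [q, π.2.1 b]
    have fp := π.2.2
    have d1 : i ≠ π j := fun q => hj (inv _ _ q)
    have d2 : i ≠ π k := fun q => hk (inv _ _ q)
    have d3 : j ≠ π k := fun q => hkj (inv _ _ q)
    have p1 : π i ≠ π j := fun q => hij (inj _ _ q)
    have p2 : π i ≠ π k := fun q => hik (inj _ _ q)
    have p3 : π j ≠ π k := fun q => hjk (inj _ _ q)
    have sum3 : ∀ a b c : ℕ, a ≠ b → a ≠ c → b ≠ c →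
        ∑ t ∈ ({a, b, c} : Finset ℕ), 2 ^ t = 2 ^ a + 2 ^ b + 2 ^ c := by
      intro a b c ab ac bc
      rw [Finset.sum_insert (by simp [ab, ac]), Finset.sum_pair bc, add_assoc]
    have n1 : e i (π j) ≠ e j (π k) := fun q => by
      have := he _ _ _ _ d1 d3 q; tauto
    have n2 : e i (π j) ≠ e k (π i) := fun q => by
      have := he _ _ _ _ d1 hk q; grind
    have n3 : e j (π k) ≠ e k (π i) := fun q => by
      have := he _ _ _ _ d3 hk q; grind
    have n4 : e i (π k) ≠ e j (π i) := fun q => by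
      have := he _ _ _ _ d2 hj q; grind
    have n5 : e i (π k) ≠ e k (π j) := fun q => by
      have := he _ _ _ _ d2 hkj q; grind
    have n6 : e j (π i) ≠ e k (π j) := fun q => by
      have := he _ _ _ _ hj hkj q; grind
    have eqs := @hinj {e i (π j), e j (π k), e k (π i)} {e i (π k), e j (π i), e k (π j)} (by
      simp only [sum3 _ _ _ n1 n2 n3, sum3 _ _ _ n4 n5 n6]
      simpa only [hge] using det')
    have mem : e i (π j) ∈ ({e i (π k), e j (π i), e k (π j)} : Finset ℕ) := by
      rw [← eqs]; simp
    simp only [Finset.mem_insert, Finset.mem_singleton] at mem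
    rcases mem with q | q | q
    · have := he _ _ _ _ d1 d2 q; grind
    · have := he _ _ _ _ d1 hj q; grind
    · have := he _ _ _ _ d1 hkj q; grind
  refine ⟨{
    height := h
    curve := f
    height_strictAnti := hh
    continuousOn_curve := fun i => by simp only [f]; fun_prop
    curve_left := fun i => by simp only [f]; ring
    curve_right := fun i => by simp only [f]; ring
    meet_at_most_once := fun i j hij x _ y _ => once i j hij x y
    mirror := fun i x _ => by simp only [f, π.2.1 i]; ring
    no_tangency := ?_
    no_triple := ?_ }⟩
  · intro i j hij x _ hx
    have hc : f i (x + 1) - f j (x + 1) ≠ 0 := fun q => by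
      have := once i j hij x (x + 1) hx (sub_eq_zero.1 q)
      linarith
    have lin : ∀ s, f i s - f j s = (s - x) * (f i (x + 1) - f j (x + 1)) := fun s => by
      simp only [f] at hx ⊢
      linear_combination (1 - (s - x)) * hx
    filter_upwards [self_mem_nhdsWithin] with s hs
    filter_upwards [self_mem_nhdsWithin] with t ht
    rw [lin s, lin t]
    have h1 : s - x < 0 := sub_neg.2 hs
    have h2 : 0 < t - x := sub_pos.2 ht
    have h3 : 0 < (f i (x + 1) - f j (x + 1)) ^ 2 := by positivity
    have h4 := mul_neg_of_neg_of_pos (mul_neg_of_neg_of_pos h1 h2) h3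
    linarith
  · rintro i j k hij hjk hik x _ ⟨e1, e2⟩
    by_cases c1 : j = π i
    · subst c1
      exact tripleA i k hik.symm hjk.symm x e1 (e1.trans e2)
    by_cases c2 : k = π i
    · subst c2
      exact tripleA i j hij.symm hjk x (e1.trans e2) e1
    by_cases c3 : k = π j
    · subst c3
      exact tripleA j i hij hik x e2 e1.symm
    exact tripleB i j k hij hjk hik c1 c2 c3 x e1 e2

variable {N : ℕ} {π : Matching (Fin N)} (E : NiceEmbedding π)

/-- The edges starting at `i` and `j` on the left are distinct and meet at abscissa `x`. -/
def MeetAt (i j : Fin N) (x : ℝ) : Prop :=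
  i ≠ j ∧ x ∈ Icc (-1 : ℝ) 1 ∧ E.curve i x = E.curve j x

/-- The crossings of the embedding. As two edges meet at most once, a crossing is given by the
unordered pair of edges that meet there; an edge is named by its left end. -/
abbrev Crossing := {c : Sym2 (Fin N) // ∃ i j x, c = s(i, j) ∧ E.MeetAt i j x}

theorem meetAt_mirror {i j : Fin N} {x : ℝ} (h : E.MeetAt i j x) :
    E.MeetAt (π i) (π j) (-x) := by
  obtain ⟨hne, hx, hc⟩ := h
  refine ⟨fun e => hne (π.2.1.injective e), ⟨by linarith [hx.2], by linarith [hx.1]⟩, ?_⟩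
  rw [E.mirror i x hx, E.mirror j x hx, hc]

/-- The mirror image of a crossing. -/
def mirrorCrossing (c : E.Crossing) : E.Crossing :=
  ⟨c.1.map π, by
    obtain ⟨_, i, j, x, rfl, h⟩ := c
    exact ⟨π i, π j, -x, rfl, E.meetAt_mirror h⟩⟩

/-- An unpaired crossing is a crossing of an edge `(i, j')` with the edge `(i', j)`; all other
crossings are paired, the partner of a crossing being its mirror image. -/
def IsUnpaired (c : E.Crossing) : Prop := ∃ i, c.1 = s(i, π i)

/-! ### Uncrossings -/

/-- The two ways to resolve an intersection of two strands that run from left to right: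
`vertical` joins the two left halves to each other and the two right halves to each other, as
in `)(`; `horizontal` joins the left half of each strand to the right half of the other one. -/
inductive Resolution
  | vertical
  | horizontal

instance : Finite Resolution :=
  Finite.of_surjective (fun b : Bool => if b then Resolution.vertical else Resolution.horizontal)
    (fun r => match r with
      | .vertical => ⟨true, rfl⟩
      | .horizontal => ⟨false, rfl⟩)

/-- The set `X(π)`: a resolution of every crossing, such that mirror images are resolved in the
same way. -/
abbrev Uncrossing :=
  {σ : E.Crossing → Resolution // ∀ c, σ (E.mirrorCrossing c) = σ c}

instance : Fintype E.Uncrossing := Fintype.ofFinite _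

/-- The abscissae of the points that cut the edge `i` into segments: its two ends and its
crossings with other edges. -/
def IsBreak (i : Fin N) (x : ℝ) : Prop :=
  x = -1 ∨ x = 1 ∨ ∃ j, E.MeetAt i j x

/-- A segment: the part of an edge between two consecutive break points. -/
@[ext] structure Segment where
  edge : Fin N
  left : ℝ
  right : ℝ
  left_lt_right : left < right
  isBreak_left : E.IsBreak edge left
  isBreak_right : E.IsBreak edge right
  not_isBreak : ∀ x, left < x → x < right → ¬ E.IsBreak edge x

/-- The boundary vertex `v` is an end of the segment `S`. -/
def IsEnd (S : E.Segment) : Vertex N → Prop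
  | Sum.inl i => S.edge = i ∧ S.left = -1
  | Sum.inr i => π S.edge = i ∧ S.right = 1

/-- `T` is the mirror image of `S`. -/
def IsMirror (S T : E.Segment) : Prop :=
  T.edge = π S.edge ∧ T.left = -S.right ∧ T.right = -S.left

variable {E}

/-- The uncrossed graph: two segments are adjacent if the resolution of a crossing of their
edges joins an end of one to an end of the other. -/
def strandGraph (σ : E.Uncrossing) : SimpleGraph E.Segment where
  Adj S T := ∃ (c : E.Crossing) (x : ℝ), c.1 = s(S.edge, T.edge) ∧ E.MeetAt S.edge T.edge x ∧
    match σ.1 c with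
    | .vertical => (S.right = x ∧ T.right = x) ∨ (S.left = x ∧ T.left = x)
    | .horizontal => (S.right = x ∧ T.left = x) ∨ (S.left = x ∧ T.right = x)
  symm := ⟨by
    rintro S T ⟨c, x, hc, ⟨hne, hx, hm⟩, h⟩
    refine ⟨c, x, hc.trans Sym2.eq_swap, ⟨hne.symm, hx, hm.symm⟩, ?_⟩
    revert h
    cases σ.1 c <;> simp only <;> tauto⟩
  loopless := ⟨by
    rintro S ⟨c, x, hc, ⟨hne, _⟩, _⟩
    exact hne rfl⟩

/-- `D(σ) = D`: the two ends of each edge of `D` are the ends of a common strand of the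
uncrossed graph. -/
def HasDiagram (σ : E.Uncrossing) (D : Matching (Vertex N)) : Prop :=
  ∀ v, ∃ S T : E.Segment, E.IsEnd S v ∧ E.IsEnd T (D v) ∧ (strandGraph σ).Reachable S T

/-- A closed loop: a component of the uncrossed graph that contains no boundary vertex. -/
def IsLoop (σ : E.Uncrossing) (L : Set E.Segment) : Prop :=
  (∃ C : (strandGraph σ).ConnectedComponent, L = C.supp) ∧ ∀ S ∈ L, ∀ v, ¬ E.IsEnd S v

/-- The number of closed loops, pairs of mirror symmetric loops being counted only once. -/
def loopNumber (σ : E.Uncrossing) : ℕ :=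
  Set.ncard {P : Set (Set E.Segment) |
    ∃ L, IsLoop σ L ∧ P = {L, {T | ∃ S ∈ L, E.IsMirror S T}}}

/-- The number of unpaired vertical uncrossings. -/
def unpairedVertical (σ : E.Uncrossing) : ℕ :=
  Set.ncard {c : E.Crossing | E.IsUnpaired c ∧ σ.1 c = .vertical}

/-- The number of paired horizontal uncrossings; a crossing and its mirror image form one
pair. -/
def pairedHorizontal (σ : E.Uncrossing) : ℕ :=
  Set.ncard {P : Set E.Crossing |
    ∃ c, ¬ E.IsUnpaired c ∧ σ.1 c = .horizontal ∧ P = {c, E.mirrorCrossing c}}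

/-- The weight `2^{l} (-1)^{uv + ph}`. -/
def weight (σ : E.Uncrossing) : ℤ :=
  2 ^ loopNumber σ * (-1) ^ (unpairedVertical σ + pairedHorizontal σ)

open Classical in
/-- The sum of the weights of the uncrossings `σ` with `D(σ) = D`. -/
def diagramWeight (E : NiceEmbedding π) (D : Matching (Vertex N)) : ℤ :=
  ∑ σ : E.Uncrossing with HasDiagram σ D, weight σ

end NiceEmbedding

/-- The diagram pfaffinant `Pfaf'_D(A)`, formed with a chosen nice embedding of `ν(π)` for
each matching `π`. -/
def diagramPfaffinant {R : Type*} [CommRing R] {n : ℕ}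
    (E : ∀ π : Matching (Fin (2 * n)), NiceEmbedding π) (D : SymTLDiagram n)
    (A : Matrix (Fin (2 * n)) (Fin (2 * n)) R) : R :=
  pfaffinant (fun π => ((E π).diagramWeight D.1 : R)) A

end TLPfaff

end

noncomputable section

namespace TLPfaff

namespace NiceEmbedding

variable {N : ℕ} {π : Matching (Fin N)} (E : NiceEmbedding π)

/-! ### Crossings and segments -/

/-! The two sides are compared at each monomial `a_π`. On the left its coefficient is 0 unless `π`
preserves `I`, and then it is `(-1)^m`, where `m` counts the crossings of `π` between arcs on the
same side of the partition `I`, `Iᶜ`. On the right it is the sum of the weights of those uncrossings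
whose diagram is `I`-compatible. This sum is evaluated as a state sum.

The factor `2^l` is a number of labelings: a mirror symmetric label modulo 2 on the segments,
constant along strands and prescribed on the boundary, has one free bit for each loop or mirror pair
of loops (`ncard_labels`). Adding the checkerboard coloring, the parity of the number of curves
above a segment, turns labels into colorings whose boundary values are the indicator of `I` on both
sides. A noncrossing diagram joins boundary positions of opposite parity, so such colorings exist
exactly for compatible diagrams (`isCompatible_iff`, `ncard_colorings`).

The sums over uncrossings and over colorings are then exchanged. For a fixed coloring, consistency
and sign are local, so the inner sum is a product over the crossings modulo reflection
(`sum_sign_consistent`). Where both resolutions are consistent their signs cancel; a factor is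
nonzero only if the colors continue along both edges, and it is `-1` only at a paired crossing of
equally colored edges (`localWeight_crossing`). The surviving coloring is constant on every edge; it
exists only if `π` preserves `I`, and is then unique (`sum_prod_localWeight`). Two crossing arcs of
`π` produce one mirror pair of paired crossings, two nested arcs produce two, disjoint arcs none, so
the signs agree (`neg_one_pow_ncard_crossings`).

Planarity enters through parities instead of the Jordan curve theorem: the total label of a strand
above a segment is constant modulo 2 along every other strand (`StrandInvariant.segmentParity_eq`),
and at the boundary it would separate the ends of interlacing chords (`isNoncrossing_diagram`). The
checkerboard is the same function with all labels equal to 1. -/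

variable {E} in
theorem MeetAt.symm {i j : Fin N} {x : ℝ} (h : E.MeetAt i j x) : E.MeetAt j i x :=
  ⟨h.1.symm, h.2.1, h.2.2.symm⟩

-- The edges have distinct heights on each side of the rectangle, so every crossing is interior.
variable {E} in
theorem MeetAt.mem_Ioo {i j : Fin N} {x : ℝ} (h : E.MeetAt i j x) : x ∈ Ioo (-1 : ℝ) 1 := by
  obtain ⟨hne, ⟨h1, h2⟩, hm⟩ := h
  refine ⟨lt_of_le_of_ne h1 ?_, lt_of_le_of_ne h2 ?_⟩
  · rintro rfl
    rw [E.curve_left, E.curve_left] at hm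
    exact hne (E.height_strictAnti.injective hm)
  · rintro rfl
    rw [E.curve_right, E.curve_right] at hm
    exact hne (π.2.1.injective (E.height_strictAnti.injective hm))

variable {E} in
theorem MeetAt.eq_abscissa {i j : Fin N} {x y : ℝ} (h : E.MeetAt i j x) (h' : E.MeetAt i j y) :
    x = y :=
  E.meet_at_most_once i j h.1 x h.2.1 y h'.2.1 h.2.2 h'.2.2

variable {E} in
theorem MeetAt.eq_edge {i j k : Fin N} {x : ℝ} (h : E.MeetAt i j x) (h' : E.MeetAt i k x) :
    j = k := by
  by_contra hjk
  exact E.no_triple j i k h.1.symm h'.1 hjk x h.2.1 ⟨h.2.2.symm, h'.2.2⟩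

/-- The reflection fixes the axis pointwise and exchanges these two edges. As edges meet at most
once, this locates every unpaired crossing. -/
theorem meetAt_partner (i : Fin N) : E.MeetAt i (π i) 0 := by
  refine ⟨(π.2.2 i).symm, by simp, ?_⟩
  have := E.mirror i 0 (by simp)
  simpa using this.symm

/-- The crossing of two edges that meet. -/
def crossing {i j : Fin N} {x : ℝ} (h : E.MeetAt i j x) : E.Crossing := ⟨s(i, j), i, j, x, rfl, h⟩

theorem crossing_symm {i j : Fin N} {x : ℝ} (h : E.MeetAt i j x) :
    E.crossing h.symm = E.crossing h := Subtype.ext Sym2.eq_swap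

theorem eq_crossing {i j : Fin N} {x : ℝ} (h : E.MeetAt i j x) {c : E.Crossing}
    (hc : c.1 = s(i, j)) : c = E.crossing h := Subtype.ext hc

theorem mirrorCrossing_crossing {i j : Fin N} {x : ℝ} (h : E.MeetAt i j x) :
    E.mirrorCrossing (E.crossing h) = E.crossing (E.meetAt_mirror h) := rfl

theorem mirrorCrossing_mirrorCrossing (c : E.Crossing) :
    E.mirrorCrossing (E.mirrorCrossing c) = c := by
  obtain ⟨_, i, j, x, rfl, h⟩ := c
  apply Subtype.ext
  simp [mirrorCrossing, π.2.1 i, π.2.1 j]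

/-! ### Break points and the segments between them. -/

variable {E} in
theorem IsBreak.mem_Icc {i : Fin N} {x : ℝ} (h : E.IsBreak i x) : x ∈ Icc (-1 : ℝ) 1 := by
  rcases h with rfl | rfl | ⟨j, h⟩
  · simp
  · simp
  · exact h.2.1

theorem isBreak_finite (i : Fin N) : {x | E.IsBreak i x}.Finite := by
  have : {x | E.IsBreak i x} ⊆ {-1, 1} ∪ ⋃ j, {x | E.MeetAt i j x} := by
    rintro x (rfl | rfl | ⟨j, h⟩)
    · simp
    · simp
    · exact Or.inr (mem_iUnion.2 ⟨j, h⟩)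
  refine (((Set.toFinite _).union (Set.finite_iUnion fun j => ?_))).subset this
  exact Set.Subsingleton.finite fun x hx y hy => hx.eq_abscissa hy

theorem isBreak_mirror {i : Fin N} {x : ℝ} (h : E.IsBreak i x) : E.IsBreak (π i) (-x) := by
  rcases h with rfl | rfl | ⟨j, h⟩
  · exact Or.inr (Or.inl (neg_neg _))
  · exact Or.inl rfl
  · exact Or.inr (Or.inr ⟨π j, E.meetAt_mirror h⟩)

theorem isBreak_mirror_iff {i : Fin N} {x : ℝ} : E.IsBreak (π i) (-x) ↔ E.IsBreak i x :=
  ⟨fun h => by simpa [π.2.1 i] using E.isBreak_mirror h, E.isBreak_mirror⟩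

/-- If `p`, `q` cut the line into a left and a right part, some segment of the edge `i` runs from
the left part to the right part. -/
theorem exists_segment (i : Fin N) {p q : ℝ → Prop} (hpq : ∀ x y, p x → q y → x < y)
    (hcov : ∀ x, p x ∨ q x) (hp : p (-1)) (hq : q 1) :
    ∃ S : E.Segment, S.edge = i ∧ p S.left ∧ q S.right := by
  -- The last break point of the left part and the first one of the right part are consecutive.
  obtain ⟨l, ⟨hlb, hlp⟩, hl⟩ := Set.exists_max_image {x | E.IsBreak i x ∧ p x} id
    ((E.isBreak_finite i).subset fun x hx => hx.1) ⟨-1, Or.inl rfl, hp⟩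
  obtain ⟨r, ⟨hrb, hrq⟩, hr⟩ := Set.exists_min_image {x | E.IsBreak i x ∧ q x} id
    ((E.isBreak_finite i).subset fun x hx => hx.1) ⟨1, Or.inr (Or.inl rfl), hq⟩
  refine ⟨⟨i, l, r, hpq _ _ hlp hrq, hlb, hrb, fun x hlx hxr hx => ?_⟩, rfl, hlp, hrq⟩
  rcases hcov x with h | h
  · exact absurd (hl x ⟨hx, h⟩) (not_le.2 hlx)
  · exact absurd (hr x ⟨hx, h⟩) (not_le.2 hxr)

theorem exists_segment_right (i : Fin N) {t : ℝ} (ht : t ∈ Ico (-1 : ℝ) 1) :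
    ∃ S : E.Segment, S.edge = i ∧ S.left ≤ t ∧ t < S.right :=
  E.exists_segment i (fun _ _ hx hy => lt_of_le_of_lt hx hy) (fun x => le_or_gt x t) ht.1 ht.2

theorem exists_segment_left (i : Fin N) {t : ℝ} (ht : t ∈ Ioc (-1 : ℝ) 1) :
    ∃ S : E.Segment, S.edge = i ∧ S.left < t ∧ t ≤ S.right :=
  E.exists_segment i (fun _ _ hx hy => lt_of_lt_of_le hx hy) (fun x => lt_or_ge x t) ht.1 ht.2

-- Otherwise an end of one segment would be a break point in the interior of the other.
variable {E} in
theorem Segment.eq_of_overlap {S T : E.Segment} (he : S.edge = T.edge) (h1 : S.left < T.right)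
    (h2 : T.left < S.right) : S = T := by
  obtain ⟨e, l, r, hlr, hl, hr, hb⟩ := S
  obtain ⟨e', l', r', hlr', hl', hr', hb'⟩ := T
  simp only at he h1 h2
  subst he
  have e1 : l = l' := by
    rcases lt_trichotomy l l' with h | h | h
    · exact absurd hl' (hb _ h h2)
    · exact h
    · exact absurd hl (hb' _ h h1)
  have e2 : r = r' := by
    rcases lt_trichotomy r r' with h | h | h
    · exact absurd hr (hb' _ h2 h)
    · exact h
    · exact absurd hr' (hb _ h1 h)
  subst e1 e2
  rfl

/-- The segment of the edge `i` at and just to the right of the abscissa `t`. -/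
def segR (i : Fin N) (t : ℝ) : E.Segment :=
  if h : t ∈ Ico (-1 : ℝ) 1 then (E.exists_segment_right i h).choose
  -- Outside the edge's range the value is irrelevant; the first segment serves as default.
  else (E.exists_segment_right i (t := -1) (by simp)).choose

/-- The segment of the edge `i` at and just to the left of the abscissa `t`. -/
def segL (i : Fin N) (t : ℝ) : E.Segment :=
  if h : t ∈ Ioc (-1 : ℝ) 1 then (E.exists_segment_left i h).choose
  else (E.exists_segment_left i (t := 1) (by simp)).choose

@[simp] theorem segR_edge (i : Fin N) (t : ℝ) : (E.segR i t).edge = i := by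
  unfold segR
  split_ifs with h
  · exact (E.exists_segment_right i h).choose_spec.1
  · exact (E.exists_segment_right i (t := -1) (by simp)).choose_spec.1

@[simp] theorem segL_edge (i : Fin N) (t : ℝ) : (E.segL i t).edge = i := by
  unfold segL
  split_ifs with h
  · exact (E.exists_segment_left i h).choose_spec.1
  · exact (E.exists_segment_left i (t := 1) (by simp)).choose_spec.1

theorem segR_spec (i : Fin N) {t : ℝ} (h : t ∈ Ico (-1 : ℝ) 1) :
    (E.segR i t).left ≤ t ∧ t < (E.segR i t).right := by
  unfold segR
  rw [dif_pos h]
  exact (E.exists_segment_right i h).choose_spec.2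

theorem segL_spec (i : Fin N) {t : ℝ} (h : t ∈ Ioc (-1 : ℝ) 1) :
    (E.segL i t).left < t ∧ t ≤ (E.segL i t).right := by
  unfold segL
  rw [dif_pos h]
  exact (E.exists_segment_left i h).choose_spec.2

variable {E}

theorem Segment.neg_one_le_left (S : E.Segment) : -1 ≤ S.left := S.isBreak_left.mem_Icc.1

theorem Segment.right_le_one (S : E.Segment) : S.right ≤ 1 := S.isBreak_right.mem_Icc.2

theorem Segment.segR_eq (S : E.Segment) {t : ℝ} (h1 : S.left ≤ t) (h2 : t < S.right) :
    E.segR S.edge t = S := by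
  have := E.segR_spec S.edge (t := t)
    ⟨S.neg_one_le_left.trans h1, h2.trans_le S.right_le_one⟩
  exact Segment.eq_of_overlap (by simp) (this.1.trans_lt h2) (h1.trans_lt this.2)

theorem Segment.segL_eq (S : E.Segment) {t : ℝ} (h1 : S.left < t) (h2 : t ≤ S.right) :
    E.segL S.edge t = S := by
  have := E.segL_spec S.edge (t := t)
    ⟨S.neg_one_le_left.trans_lt h1, h2.trans S.right_le_one⟩
  exact Segment.eq_of_overlap (by simp) (this.1.trans_le h2) (h1.trans_le this.2)

theorem Segment.segR_left (S : E.Segment) : E.segR S.edge S.left = S :=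
  S.segR_eq le_rfl S.left_lt_right

theorem Segment.segL_right (S : E.Segment) : E.segL S.edge S.right = S :=
  S.segL_eq S.left_lt_right le_rfl

variable (E)

theorem segR_left {i : Fin N} {t : ℝ} (ht : t ∈ Ico (-1 : ℝ) 1) (hb : E.IsBreak i t) :
    (E.segR i t).left = t := by
  have := E.segR_spec i ht
  by_contra hne
  refine (E.segR i t).not_isBreak t (lt_of_le_of_ne this.1 hne) this.2 ?_
  rwa [segR_edge]

theorem segL_right {i : Fin N} {t : ℝ} (ht : t ∈ Ioc (-1 : ℝ) 1) (hb : E.IsBreak i t) :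
    (E.segL i t).right = t := by
  have := E.segL_spec i ht
  by_contra hne
  refine (E.segL i t).not_isBreak t this.1 (lt_of_le_of_ne this.2 (Ne.symm hne)) ?_
  rwa [segL_edge]

theorem segL_eq_segR {i : Fin N} {t : ℝ} (ht : t ∈ Ioo (-1 : ℝ) 1) (hb : ¬ E.IsBreak i t) :
    E.segL i t = E.segR i t := by
  have h := E.segL_spec i (Ioo_subset_Ioc_self ht)
  have hne : t ≠ (E.segL i t).right := fun e => hb (by
    have := (E.segL i t).isBreak_right
    rwa [segL_edge, ← e] at this)
  have := (E.segL i t).segR_eq h.1.le (lt_of_le_of_ne h.2 hne)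
  rw [segL_edge] at this
  exact this.symm

theorem eventually_segR_right (i : Fin N) {t : ℝ} (ht : t ∈ Ico (-1 : ℝ) 1) :
    ∀ᶠ s in 𝓝[>] t, E.segR i s = E.segR i t := by
  have h := E.segR_spec i ht
  filter_upwards [Ioo_mem_nhdsGT h.2] with s hs
  have := (E.segR i t).segR_eq (h.1.trans hs.1.le) hs.2
  rwa [segR_edge] at this

/-- Left limits of functions written with `segR` are therefore expressed by `segL`; this is how
parities on the two sides of a crossing are compared. -/
theorem eventually_segR_left (i : Fin N) {t : ℝ} (ht : t ∈ Ioc (-1 : ℝ) 1) :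
    ∀ᶠ s in 𝓝[<] t, E.segR i s = E.segL i t := by
  have h := E.segL_spec i ht
  filter_upwards [Ioo_mem_nhdsLT h.1] with s hs
  have := (E.segL i t).segR_eq hs.1.le (hs.2.trans_le h.2)
  rwa [segL_edge] at this

/-- An edge has finitely many break points, and a segment is determined by its edge and its left
end. -/
instance : Finite E.Segment := by
  have : ∀ i, Finite {x // E.IsBreak i x} := fun i => (E.isBreak_finite i).to_subtype
  refine Finite.of_injective
    (fun S : E.Segment => (⟨S.edge, S.left, S.isBreak_left⟩ : Σ i, {x // E.IsBreak i x})) ?_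
  intro S T h
  have h1 : S.edge = T.edge := congrArg Sigma.fst h
  have h2 : S.left = T.left := congrArg (fun p : Σ i, {x // E.IsBreak i x} => p.2.1) h
  rw [← S.segR_left, ← T.segR_left, h1, h2]

/-- The segment that ends at a boundary vertex. -/
def endSegment : Vertex N → E.Segment
  | Sum.inl i => E.segR i (-1)
  | Sum.inr i => E.segL (π i) 1

theorem isEnd_iff {S : E.Segment} {v : Vertex N} : E.IsEnd S v ↔ S = E.endSegment v := by
  rcases v with i | i
  · constructor
    · rintro ⟨rfl, h⟩
      rw [endSegment, ← h, S.segR_left]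
    · rintro rfl
      exact ⟨by simp [endSegment], E.segR_left (by simp) (Or.inl rfl)⟩
  · constructor
    · rintro ⟨rfl, h⟩
      rw [endSegment, ← h, π.2.1, S.segL_right]
    · rintro rfl
      exact ⟨by simp [endSegment, π.2.1 i], E.segL_right (by simp) (Or.inr (Or.inl rfl))⟩

/-- The mirror image of a segment. -/
def mirrorSegment (S : E.Segment) : E.Segment where
  edge := π S.edge
  left := -S.right
  right := -S.left
  left_lt_right := neg_lt_neg S.left_lt_right
  isBreak_left := E.isBreak_mirror S.isBreak_right
  isBreak_right := E.isBreak_mirror S.isBreak_left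
  not_isBreak x h1 h2 h := S.not_isBreak (-x) (lt_neg_of_lt_neg h2) (neg_lt_of_neg_lt h1)
    (E.isBreak_mirror_iff.1 (by rwa [neg_neg]))

theorem isMirror_iff {S T : E.Segment} : E.IsMirror S T ↔ T = E.mirrorSegment S :=
  ⟨fun ⟨h1, h2, h3⟩ => Segment.ext h1 h2 h3, fun h => by rw [h]; exact ⟨rfl, rfl, rfl⟩⟩

theorem mirrorSegment_mirrorSegment (S : E.Segment) :
    E.mirrorSegment (E.mirrorSegment S) = S :=
  Segment.ext (π.2.1 _) (neg_neg _) (neg_neg _)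

theorem mirrorSegment_segR (i : Fin N) {t : ℝ} (ht : t ∈ Ico (-1 : ℝ) 1) :
    E.mirrorSegment (E.segR i t) = E.segL (π i) (-t) := by
  have h := E.segR_spec i ht
  have := (E.mirrorSegment (E.segR i t)).segL_eq (t := -t) (neg_lt_neg h.2) (neg_le_neg h.1)
  rw [← this]
  simp [mirrorSegment]

theorem mirrorSegment_segL (i : Fin N) {t : ℝ} (ht : t ∈ Ioc (-1 : ℝ) 1) :
    E.mirrorSegment (E.segL i t) = E.segR (π i) (-t) := by
  have h := E.segL_spec i ht
  have := (E.mirrorSegment (E.segL i t)).segR_eq (t := -t) (neg_le_neg h.2) (neg_lt_neg h.1)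
  rw [← this]
  simp [mirrorSegment]

theorem mirrorSegment_endSegment (v : Vertex N) :
    E.mirrorSegment (E.endSegment v) = E.endSegment v.swap := by
  rcases v with i | i
  · simpa [endSegment] using E.mirrorSegment_segR i (t := -1) (by simp)
  · simpa [endSegment, π.2.1 i] using E.mirrorSegment_segL (π i) (t := 1) (by simp)

end NiceEmbedding

/-! ### Locally constant functions and one-sided neighborhoods. -/

theorem eq_of_eventually_eq_nhds {α : Type*} {f : ℝ → α} {a b : ℝ}
    (hf : ∀ t ∈ Ioo a b, ∀ᶠ s in 𝓝 t, f s = f t) {s t : ℝ} (hs : s ∈ Ioo a b)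
    (ht : t ∈ Ioo a b) : f s = f t := by
  -- For the discrete topology on the target, local constancy is continuity.
  let _ : TopologicalSpace α := ⊥
  have _ : DiscreteTopology α := ⟨rfl⟩
  refine isPreconnected_Ioo.constant (f := f) (fun u hu => ?_) hs ht
  exact (continuousAt_const.congr ((hf u hu).mono fun _ h => h.symm)).continuousWithinAt

theorem eventually_nhds_of_sides {p : ℝ → Prop} {t : ℝ} (h1 : ∀ᶠ s in 𝓝[<] t, p s) (h2 : p t)
    (h3 : ∀ᶠ s in 𝓝[>] t, p s) : ∀ᶠ s in 𝓝 t, p s := by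
  rw [← nhdsNE_sup_pure, ← nhdsLT_sup_nhdsGT]
  simp only [eventually_sup, eventually_pure]
  exact ⟨⟨h1, h3⟩, h2⟩

theorem nhdsGT_le_nhdsWithin_Icc {t : ℝ} (ht : t ∈ Ico (-1 : ℝ) 1) :
    𝓝[>] t ≤ 𝓝[Icc (-1) 1] t :=
  nhdsWithin_le_of_mem (mem_of_superset (Ioo_mem_nhdsGT ht.2)
    fun _ hs => ⟨ht.1.trans hs.1.le, hs.2.le⟩)

theorem nhdsLT_le_nhdsWithin_Icc {t : ℝ} (ht : t ∈ Ioc (-1 : ℝ) 1) :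
    𝓝[<] t ≤ 𝓝[Icc (-1) 1] t :=
  nhdsWithin_le_of_mem (mem_of_superset (Ioo_mem_nhdsLT ht.1)
    fun _ hs => ⟨hs.1.le, hs.2.le.trans ht.2⟩)

namespace NiceEmbedding

variable {N : ℕ} {π : Matching (Fin N)} (E : NiceEmbedding π)

/-! ### The parity of the weighted number of segments above a segment -/

theorem eventually_curve_lt_iff {i j : Fin N} {t : ℝ} (ht : t ∈ Icc (-1 : ℝ) 1)
    (hne : E.curve i t ≠ E.curve j t) :
    ∀ᶠ s in 𝓝[Icc (-1) 1] t, (E.curve i s < E.curve j s ↔ E.curve i t < E.curve j t) := by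
  have hi := E.continuousOn_curve i t ht
  have hj := E.continuousOn_curve j t ht
  rcases lt_or_gt_of_ne hne with h | h
  · filter_upwards [hi.eventually_lt hj h] with s hs
    exact iff_of_true hs h
  · filter_upwards [hj.eventually_lt hi h] with s hs
    exact iff_of_false hs.not_gt h.not_gt

/-- The total weight of the segments above the edge `i` at the abscissa `t`. -/
def heightParity (h : E.Segment → ZMod 2) (i : Fin N) (t : ℝ) : ZMod 2 :=
  ∑ j with E.curve i t < E.curve j t, h (E.segR j t)

theorem eventually_heightParity_of_not_meet {h : E.Segment → ZMod 2} {i : Fin N} {t : ℝ}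
    (ht : t ∈ Icc (-1 : ℝ) 1) (hno : ∀ k, ¬ E.MeetAt i k t) {l : Filter ℝ}
    (hl : l ≤ 𝓝[Icc (-1) 1] t) {g : Fin N → ZMod 2}
    (hg : ∀ j, ∀ᶠ s in l, h (E.segR j s) = g j) :
    ∀ᶠ s in l, E.heightParity h i s = ∑ j with E.curve i t < E.curve j t, g j := by
  have h1 : ∀ j, ∀ᶠ s in l, (E.curve i s < E.curve j s ↔ E.curve i t < E.curve j t) := by
    intro j
    by_cases hij : i = j
    · subst hij; simp
    · exact hl (E.eventually_curve_lt_iff ht fun e => hno j ⟨hij, ht, e⟩)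
  filter_upwards [eventually_all.2 h1, eventually_all.2 hg] with s hs hs'
  simp only [heightParity, hs, hs']

/-- No third edge passes through the crossing, so `k` is the only edge whose order relative to `i`
can change nearby; its term is split off. -/
theorem eventually_heightParity_of_meet {h : E.Segment → ZMod 2} {i k : Fin N} {t : ℝ}
    (hik : E.MeetAt i k t) {l : Filter ℝ}
    (hl : l ≤ 𝓝[Icc (-1) 1] t) {g : Fin N → ZMod 2}
    (hg : ∀ j, ∀ᶠ s in l, h (E.segR j s) = g j) :
    ∀ᶠ s in l, E.heightParity h i s =
      (∑ j with E.curve i t < E.curve j t, g j) + if E.curve i s < E.curve k s then g k else 0 := by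
  have h1 : ∀ j, j ≠ k → ∀ᶠ s in l,
      (E.curve i s < E.curve j s ↔ E.curve i t < E.curve j t) := by
    intro j hjk
    by_cases hij : i = j
    · subst hij; simp
    · exact hl (E.eventually_curve_lt_iff hik.2.1
        fun e => hjk (MeetAt.eq_edge ⟨hij, hik.2.1, e⟩ hik))
  filter_upwards [eventually_all.2 fun j => eventually_imp_distrib_left.2 (h1 j),
    eventually_all.2 hg] with s hs hs'
  simp only [heightParity, hs', Finset.sum_filter]
  have hk : (if E.curve i s < E.curve k s then g k else 0) =
      ∑ j, if j = k then (if E.curve i s < E.curve j s then g j else 0) else 0 := by simp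
  rw [hk, ← Finset.sum_add_distrib]
  refine Finset.sum_congr rfl fun j _ => ?_
  by_cases hjk : j = k
  · subst hjk
    simp [hik.2.2]
  · simp [hjk, hs j hjk]

/-- At each crossing the incoming and the outgoing segments have the same total weight. -/
def Balanced (h : E.Segment → ZMod 2) : Prop :=
  ∀ i j t, E.MeetAt i j t →
    h (E.segL i t) + h (E.segL j t) = h (E.segR i t) + h (E.segR j t)

variable {E}
variable {h : E.Segment → ZMod 2}

/-- Edges that meet at `t` do so in pairs of equal height, so both or neither lie above `y`, and
balance cancels the pair modulo 2. Any other edge has the same segment on both sides of `t`. -/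
theorem Balanced.sum_segL (hb : E.Balanced h) {t : ℝ} (ht : t ∈ Ioo (-1 : ℝ) 1) (y : ℝ) :
    ∑ j with y < E.curve j t, h (E.segL j t) = ∑ j with y < E.curve j t, h (E.segR j t) := by
  classical
  rw [← CharTwo.add_eq_zero, ← Finset.sum_add_distrib]
  have hP : ∀ j, ¬ (∃ k, E.MeetAt j k t) → E.segL j t = E.segR j t := fun j hj =>
    E.segL_eq_segR ht (by
      rintro (e | e | hk)
      · exact ht.1.ne' e
      · exact ht.2.ne e
      · exact hj hk)
  refine Finset.sum_involution
    (fun j _ => if H : ∃ k, E.MeetAt j k t then H.choose else j) ?_ ?_ ?_ ?_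
  · intro j _
    split_ifs with H
    · have := hb _ _ _ H.choose_spec
      rw [add_add_add_comm, this, CharTwo.add_self_eq_zero]
    · rw [hP j H, CharTwo.add_self_eq_zero]
  · intro j _ hj
    split_ifs with H
    · exact H.choose_spec.1.symm
    · rw [hP j H, CharTwo.add_self_eq_zero] at hj
      exact absurd rfl hj
  · intro j hj
    split_ifs with H
    · simpa [H.choose_spec.2.2] using hj
    · exact hj
  · intro j hj
    by_cases H : ∃ k, E.MeetAt j k t
    · have H' : ∃ k, E.MeetAt H.choose k t := ⟨j, H.choose_spec.symm⟩
      rw [dif_pos (by simpa only [dif_pos H] using H')]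
      simp only [dif_pos H]
      exact MeetAt.eq_edge H'.choose_spec H.choose_spec.symm
    · simp [H]

theorem eventually_heightParity_right (h : E.Segment → ZMod 2) {i : Fin N} {t : ℝ} (ht : t ∈ Ico (-1 : ℝ) 1)
    (hno : ∀ k, ¬ E.MeetAt i k t) :
    ∀ᶠ s in 𝓝[>] t, E.heightParity h i s = E.heightParity h i t :=
  E.eventually_heightParity_of_not_meet (Ico_subset_Icc_self ht) hno
    (nhdsGT_le_nhdsWithin_Icc ht)
    (fun j => (E.eventually_segR_right j ht).mono fun _ h => by rw [h])

theorem Balanced.eventually_left (hb : E.Balanced h) {i : Fin N} {t : ℝ} (ht : t ∈ Ioo (-1 : ℝ) 1)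
    (hno : ∀ k, ¬ E.MeetAt i k t) :
    ∀ᶠ s in 𝓝[<] t, E.heightParity h i s = E.heightParity h i t := by
  have := E.eventually_heightParity_of_not_meet (h := h) (Ioo_subset_Icc_self ht) hno
    (nhdsLT_le_nhdsWithin_Icc (Ioo_subset_Ioc_self ht))
    (fun j => (E.eventually_segR_left j (Ioo_subset_Ioc_self ht)).mono fun _ h => by rw [h])
  rwa [hb.sum_segL ht] at this

/-- Inside `S` there is no crossing on its own edge, and crossings higher up do not change the total
by balance. Hence any interior abscissa may be used to define the parity of a segment. -/
theorem Balanced.heightParity_eq (hb : E.Balanced h) (S : E.Segment) {s t : ℝ} (hs : s ∈ Ioo S.left S.right)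
    (ht : t ∈ Ioo S.left S.right) : E.heightParity h S.edge s = E.heightParity h S.edge t := by
  refine eq_of_eventually_eq_nhds (fun u hu => ?_) hs ht
  have hu' : u ∈ Ioo (-1 : ℝ) 1 :=
    ⟨S.neg_one_le_left.trans_lt hu.1, hu.2.trans_le S.right_le_one⟩
  have hno : ∀ k, ¬ E.MeetAt S.edge k u := fun k hk =>
    S.not_isBreak u hu.1 hu.2 (Or.inr (Or.inr ⟨k, hk⟩))
  exact eventually_nhds_of_sides (hb.eventually_left hu' hno) rfl
    (eventually_heightParity_right h (Ioo_subset_Ico_self hu') hno)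

/-- The total weight of the segments above `S`. -/
def segmentParity (h : E.Segment → ZMod 2) (S : E.Segment) : ZMod 2 :=
  E.heightParity h S.edge ((S.left + S.right) / 2)

theorem Segment.midpoint_mem (S : E.Segment) : (S.left + S.right) / 2 ∈ Ioo S.left S.right :=
  ⟨by linarith [S.left_lt_right], by linarith [S.left_lt_right]⟩

theorem Balanced.eventually_segmentParity_right (hb : E.Balanced h) {i : Fin N} {t : ℝ} (ht : t ∈ Ico (-1 : ℝ) 1) :
    ∀ᶠ s in 𝓝[>] t, E.heightParity h i s = segmentParity h (E.segR i t) := by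
  have hs := E.segR_spec i ht
  filter_upwards [Ioo_mem_nhdsGT hs.2] with s hs'
  have := hb.heightParity_eq (E.segR i t) ⟨hs.1.trans_lt hs'.1, hs'.2⟩
    (E.segR i t).midpoint_mem
  rw [segmentParity]
  rwa [segR_edge] at this ⊢

theorem Balanced.eventually_segmentParity_left (hb : E.Balanced h) {i : Fin N} {t : ℝ} (ht : t ∈ Ioc (-1 : ℝ) 1) :
    ∀ᶠ s in 𝓝[<] t, E.heightParity h i s = segmentParity h (E.segL i t) := by
  have hs := E.segL_spec i ht
  filter_upwards [Ioo_mem_nhdsLT hs.1] with s hs'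
  have := hb.heightParity_eq (E.segL i t) ⟨hs'.1, hs'.2.trans_le hs.2⟩
    (E.segL i t).midpoint_mem
  rw [segmentParity]
  rwa [segL_edge] at this ⊢

/-- The four segments at a crossing; `ε` tells whether the second edge comes in above the first
one, and then it goes out below it. -/
theorem Balanced.segmentParity_crossing (hb : E.Balanced h) {i k : Fin N} {t : ℝ} (hik : E.MeetAt i k t) :
    ∃ B ε : ZMod 2,
      segmentParity h (E.segL i t) = B + ε * h (E.segL k t) ∧
      segmentParity h (E.segL k t) = B + (1 + ε) * h (E.segL i t) ∧
      segmentParity h (E.segR i t) = B + (1 + ε) * h (E.segR k t) ∧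
      segmentParity h (E.segR k t) = B + ε * h (E.segR i t) := by
  have ht := hik.mem_Ioo
  have htL := Ioo_subset_Ioc_self ht
  have htR := Ioo_subset_Ico_self ht
  have gL : ∀ j, ∀ᶠ s in 𝓝[<] t, h (E.segR j s) = h (E.segL j t) := fun j =>
    (E.eventually_segR_left j htL).mono fun _ h => by rw [h]
  have gR : ∀ j, ∀ᶠ s in 𝓝[>] t, h (E.segR j s) = h (E.segR j t) := fun j =>
    (E.eventually_segR_right j htR).mono fun _ h => by rw [h]
  have L := nhdsLT_le_nhdsWithin_Icc htL
  have R := nhdsGT_le_nhdsWithin_Icc htR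
  obtain ⟨s, hs, a1, a2, a3, a4⟩ := ((E.no_tangency i k hik.1 t hik.2.1 hik.2.2).and
    ((hb.eventually_segmentParity_left (i := i) htL).and
    ((hb.eventually_segmentParity_left (i := k) htL).and
    ((E.eventually_heightParity_of_meet hik L gL).and
    (E.eventually_heightParity_of_meet hik.symm L gL))))).exists
  obtain ⟨u, hu, b1, b2, b3, b4⟩ := (hs.and
    ((hb.eventually_segmentParity_right (i := i) htR).and
    ((hb.eventually_segmentParity_right (i := k) htR).and
    ((E.eventually_heightParity_of_meet hik R gR).and
    (E.eventually_heightParity_of_meet hik.symm R gR))))).exists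
  rw [a1, hb.sum_segL ht] at a3
  rw [a2, hb.sum_segL ht, ← hik.2.2] at a4
  rw [b1] at b3
  rw [b2, ← hik.2.2] at b4
  -- `B` is the weight strictly above the crossing point, equal on both sides by `sum_segL`. The
  -- sign change in `hu` puts `k` below `i` after the crossing if it was above before, and
  -- conversely.
  refine ⟨∑ j with E.curve i t < E.curve j t, h (E.segR j t), if E.curve i s < E.curve k s then 1 else 0, ?_, ?_, ?_, ?_⟩
  · rw [a3]; simp
  · rw [a4]
    rcases mul_neg_iff.1 hu with ⟨p, q⟩ | ⟨p, q⟩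
    · rw [if_pos (sub_pos.1 p), if_neg (sub_pos.1 p).not_gt]; simp
    · rw [if_neg (sub_neg.1 p).not_gt, if_pos (sub_neg.1 p)]; simp [CharTwo.add_self_eq_zero]
  · rw [b3]
    rcases mul_neg_iff.1 hu with ⟨p, q⟩ | ⟨p, q⟩
    · rw [if_neg (sub_pos.1 p).not_gt, if_pos (sub_neg.1 q)]; simp
    · rw [if_pos (sub_neg.1 p), if_neg (sub_pos.1 q).not_gt]; simp [CharTwo.add_self_eq_zero]
  · rw [b4]
    rcases mul_neg_iff.1 hu with ⟨p, q⟩ | ⟨p, q⟩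
    · rw [if_neg (sub_pos.1 p).not_gt, if_neg (sub_neg.1 q).not_gt]; simp
    · rw [if_pos (sub_neg.1 p), if_pos (sub_pos.1 q)]; simp

theorem Balanced.segmentParity_endSegment_inl (hb : E.Balanced h) (i : Fin N) :
    segmentParity h (E.endSegment (Sum.inl i)) =
      ∑ j with j < i, h (E.endSegment (Sum.inl j)) := by
  have ht : (-1 : ℝ) ∈ Ico (-1 : ℝ) 1 := by simp
  have hno : ∀ k, ¬ E.MeetAt i k (-1) := fun k hk => lt_irrefl _ hk.mem_Ioo.1
  obtain ⟨s, h1, h2⟩ := ((hb.eventually_segmentParity_right (i := i) ht).and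
    (eventually_heightParity_right h ht hno)).exists
  rw [endSegment, ← h1, h2, heightParity]
  simp only [E.curve_left, E.height_strictAnti.lt_iff_gt, endSegment]

theorem Balanced.segmentParity_endSegment_inr (hb : E.Balanced h) (i : Fin N) :
    segmentParity h (E.endSegment (Sum.inr i)) =
      ∑ j with j < i, h (E.endSegment (Sum.inr j)) := by
  have ht : (1 : ℝ) ∈ Ioc (-1 : ℝ) 1 := by simp
  have hno : ∀ k, ¬ E.MeetAt (π i) k 1 := fun k hk => lt_irrefl _ hk.mem_Ioo.2
  obtain ⟨s, h1, h2⟩ := ((hb.eventually_segmentParity_left (i := π i) ht).and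
    (E.eventually_heightParity_of_not_meet (h := h) (by simp) hno
    (nhdsLT_le_nhdsWithin_Icc ht)
    (fun j => (E.eventually_segR_left j ht).mono fun _ h => by rw [h]))).exists
  rw [endSegment, ← h1, h2]
  simp only [E.curve_right, E.height_strictAnti.lt_iff_gt, endSegment, π.2.1 i, Finset.sum_filter]
  -- The edge ending at `j'` is the one starting at `π j`.
  rw [← Equiv.sum_comp π.2.1.toPerm]
  simp [π.2.1 _]

end NiceEmbedding

namespace NiceEmbedding

variable {N : ℕ} {π : Matching (Fin N)} (E : NiceEmbedding π)

/-! ### Labels that are constant along strands, and the checkerboard coloring -/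

/-- A resolution joins ends with equal labels, where the two strands at the crossing have the
labels `a`, `b` on the left and `c`, `d` on the right. -/
def Resolution.Joins : Resolution → ZMod 2 → ZMod 2 → ZMod 2 → ZMod 2 → Prop
  | .vertical, a, b, c, d => a = b ∧ c = d
  | .horizontal, a, b, c, d => a = d ∧ b = c

variable {E}

/-- The segment reached from the right end of the edge `i` at its crossing with `k`. -/
def rightNext (σ : E.Uncrossing) {i k : Fin N} {t : ℝ} (h : E.MeetAt i k t) : E.Segment :=
  match σ.1 (E.crossing h) with
  | .vertical => E.segL k t
  | .horizontal => E.segR k t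

/-- The segment reached from the left end of the edge `i` at its crossing with `k`. -/
def leftNext (σ : E.Uncrossing) {i k : Fin N} {t : ℝ} (h : E.MeetAt i k t) : E.Segment :=
  match σ.1 (E.crossing h) with
  | .vertical => E.segR k t
  | .horizontal => E.segL k t

@[simp] theorem rightNext_edge (σ : E.Uncrossing) {i k : Fin N} {t : ℝ} (h : E.MeetAt i k t) :
    (rightNext σ h).edge = k := by
  unfold rightNext
  split <;> simp

@[simp] theorem leftNext_edge (σ : E.Uncrossing) {i k : Fin N} {t : ℝ} (h : E.MeetAt i k t) :
    (leftNext σ h).edge = k := by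
  unfold leftNext
  split <;> simp

theorem MeetAt.isBreak {i k : Fin N} {t : ℝ} (h : E.MeetAt i k t) : E.IsBreak i t :=
  Or.inr (Or.inr ⟨k, h⟩)

theorem MeetAt.segL_right {i k : Fin N} {t : ℝ} (h : E.MeetAt i k t) : (E.segL i t).right = t :=
  E.segL_right (Ioo_subset_Ioc_self h.mem_Ioo) h.isBreak

theorem MeetAt.segR_left {i k : Fin N} {t : ℝ} (h : E.MeetAt i k t) : (E.segR i t).left = t :=
  E.segR_left (Ioo_subset_Ico_self h.mem_Ioo) h.isBreak

theorem adj_rightNext (σ : E.Uncrossing) {i k : Fin N} {t : ℝ} (h : E.MeetAt i k t) :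
    (strandGraph σ).Adj (E.segL i t) (rightNext σ h) := by
  refine ⟨E.crossing h, t, by simp [crossing], by simpa using h, ?_⟩
  unfold rightNext
  cases σ.1 (E.crossing h) with
  | vertical => exact Or.inl ⟨h.segL_right, h.symm.segL_right⟩
  | horizontal => exact Or.inl ⟨h.segL_right, h.symm.segR_left⟩

theorem adj_leftNext (σ : E.Uncrossing) {i k : Fin N} {t : ℝ} (h : E.MeetAt i k t) :
    (strandGraph σ).Adj (E.segR i t) (leftNext σ h) := by
  refine ⟨E.crossing h, t, by simp [crossing], by simpa using h, ?_⟩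
  unfold leftNext
  cases σ.1 (E.crossing h) with
  | vertical => exact Or.inr ⟨h.segR_left, h.symm.segR_left⟩
  | horizontal => exact Or.inr ⟨h.segR_left, h.symm.segL_right⟩

theorem strandGraph_adj_iff (σ : E.Uncrossing) (S T : E.Segment) :
    (strandGraph σ).Adj S T ↔ (∃ k, ∃ h : E.MeetAt S.edge k S.right, T = rightNext σ h) ∨
      ∃ k, ∃ h : E.MeetAt S.edge k S.left, T = leftNext σ h := by
  constructor
  · rintro ⟨c, x, hc, h, hr⟩
    obtain rfl := E.eq_crossing h hc
    cases hσ : σ.1 (E.crossing h) with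
    | vertical =>
      rw [hσ] at hr
      rcases hr with ⟨rfl, hT⟩ | ⟨rfl, hT⟩
      · exact Or.inl ⟨_, h, by rw [rightNext, hσ, ← hT, T.segL_right]⟩
      · exact Or.inr ⟨_, h, by rw [leftNext, hσ, ← hT, T.segR_left]⟩
    | horizontal =>
      rw [hσ] at hr
      rcases hr with ⟨rfl, hT⟩ | ⟨rfl, hT⟩
      · exact Or.inl ⟨_, h, by rw [rightNext, hσ, ← hT, T.segR_left]⟩
      · exact Or.inr ⟨_, h, by rw [leftNext, hσ, ← hT, T.segL_right]⟩
  · rintro (⟨k, h, rfl⟩ | ⟨k, h, rfl⟩)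
    · have := adj_rightNext σ h
      rwa [S.segL_right] at this
    · have := adj_leftNext σ h
      rwa [S.segR_left] at this

/-- The label `g` is constant along the strands. -/
def StrandInvariant (σ : E.Uncrossing) (g : E.Segment → ZMod 2) : Prop :=
  ∀ S T, (strandGraph σ).Adj S T → g S = g T

/-- Constancy along strands becomes one condition per crossing, which is what lets the state sum
factor. -/
theorem strandInvariant_iff (σ : E.Uncrossing) (g : E.Segment → ZMod 2) :
    StrandInvariant σ g ↔ ∀ i k t (h : E.MeetAt i k t),
      (σ.1 (E.crossing h)).Joins (g (E.segL i t)) (g (E.segL k t)) (g (E.segR i t))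
        (g (E.segR k t)) := by
  constructor
  · intro hg i k t h
    have h1 := hg _ _ (adj_rightNext σ h)
    have h2 := hg _ _ (adj_leftNext σ h)
    unfold rightNext at h1
    unfold leftNext at h2
    revert h1 h2
    cases σ.1 (E.crossing h) with
    | vertical => exact fun h1 h2 => ⟨h1, h2⟩
    | horizontal => exact fun h1 h2 => ⟨h1, h2.symm⟩
  · intro hg S T hST
    rcases (strandGraph_adj_iff σ S T).1 hST with ⟨k, h, rfl⟩ | ⟨k, h, rfl⟩
    · have := hg _ _ _ h
      unfold rightNext
      revert this
      rw [S.segL_right]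
      cases σ.1 (E.crossing h) with
      | vertical => exact fun h => h.1
      | horizontal => exact fun h => h.1
    · have := hg _ _ _ h
      unfold leftNext
      revert this
      rw [S.segR_left]
      cases σ.1 (E.crossing h) with
      | vertical => exact fun h => h.2
      | horizontal => exact fun h => h.2.symm

theorem StrandInvariant.balanced {σ : E.Uncrossing} {g : E.Segment → ZMod 2}
    (hg : StrandInvariant σ g) : E.Balanced g := by
  intro i k t h
  have := (strandInvariant_iff σ g).1 hg i k t h
  revert this
  cases σ.1 (E.crossing h) with
  | vertical =>
    rintro ⟨h1, h2⟩
    rw [h1, h2, CharTwo.add_self_eq_zero, CharTwo.add_self_eq_zero]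
  | horizontal =>
    rintro ⟨h1, h2⟩
    rw [h1, h2, add_comm]

theorem StrandInvariant.eq_of_reachable {σ : E.Uncrossing} {g : E.Segment → ZMod 2}
    (hg : StrandInvariant σ g) {S T : E.Segment} (h : (strandGraph σ).Reachable S T) :
    g S = g T := by
  obtain ⟨p⟩ := h
  induction p with
  | nil => rfl
  | cons hadj _ ih => exact (hg _ _ hadj).trans ih

/-- At a horizontal uncrossing the other strand stays on the same side and contributes the same
label before and after. At a vertical one the two joined segments both have label 0, so both
parities are the weight above the crossing. -/
theorem StrandInvariant.segmentParity_eq {σ : E.Uncrossing} {g : E.Segment → ZMod 2}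
    (hg : StrandInvariant σ g) {S T : E.Segment} (hadj : (strandGraph σ).Adj S T) (h0 : g S = 0) :
    segmentParity g S = segmentParity g T := by
  have key : ∀ i k t (h : E.MeetAt i k t),
      (g (E.segL i t) = 0 → segmentParity g (E.segL i t) = segmentParity g (rightNext σ h)) ∧
      (g (E.segR i t) = 0 → segmentParity g (E.segR i t) = segmentParity g (leftNext σ h)) := by
    intro i k t h
    obtain ⟨B, ε, h1, h2, h3, h4⟩ := hg.balanced.segmentParity_crossing h
    have := (strandInvariant_iff σ g).1 hg i k t h
    unfold rightNext leftNext
    revert this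
    cases σ.1 (E.crossing h) with
    | vertical =>
      rintro ⟨j1, j2⟩
      simp only
      rw [h1, h2, h3, h4, ← j1, ← j2]
      exact ⟨fun h => by simp [h], fun h => by simp [h]⟩
    | horizontal =>
      rintro ⟨j1, j2⟩
      simp only
      rw [h1, h2, h3, h4, ← j1, ← j2]
      exact ⟨fun _ => by simp, fun _ => by simp⟩
  rcases (strandGraph_adj_iff σ S T).1 hadj with ⟨k, h, rfl⟩ | ⟨k, h, rfl⟩
  · have := (key _ _ _ h).1
    rw [S.segL_right] at this
    exact this h0
  · have := (key _ _ _ h).2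
    rw [S.segR_left] at this
    exact this h0

theorem StrandInvariant.segmentParity_eq_of_reachable {σ : E.Uncrossing}
    {g : E.Segment → ZMod 2} (hg : StrandInvariant σ g) {S T : E.Segment}
    (h : (strandGraph σ).Reachable S T) (h0 : g S = 0) :
    segmentParity g S = segmentParity g T := by
  obtain ⟨p⟩ := h
  induction p with
  | nil => rfl
  | cons hadj _ ih => exact (hg.segmentParity_eq hadj h0).trans (ih ((hg _ _ hadj).symm.trans h0))

variable (E)

/-- The checkerboard coloring: the parity of the number of segments above a segment. -/
def checkerboard (S : E.Segment) : ZMod 2 := segmentParity (fun _ => 1) S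

theorem balanced_one : E.Balanced fun _ => 1 := fun _ _ _ _ => rfl

-- The two edges are adjacent in height near the crossing and exchange their ranks there.
variable {E} in
theorem MeetAt.checkerboard {i k : Fin N} {t : ℝ} (h : E.MeetAt i k t) :
    E.checkerboard (E.segL i t) + E.checkerboard (E.segL k t) = 1 ∧
    E.checkerboard (E.segR i t) + E.checkerboard (E.segR k t) = 1 ∧
    E.checkerboard (E.segL i t) = E.checkerboard (E.segR k t) ∧
    E.checkerboard (E.segL k t) = E.checkerboard (E.segR i t) := by
  obtain ⟨B, ε, h1, h2, h3, h4⟩ := E.balanced_one.segmentParity_crossing h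
  unfold NiceEmbedding.checkerboard
  rw [h1, h2, h3, h4]
  clear h1 h2 h3 h4
  revert B ε
  decide

theorem checkerboard_endSegment_inl (i : Fin N) :
    E.checkerboard (E.endSegment (Sum.inl i)) = ((i : ℕ) : ZMod 2) := by
  rw [checkerboard, E.balanced_one.segmentParity_endSegment_inl]
  simp [Finset.filter_gt_eq_Iio]

theorem checkerboard_endSegment_inr (i : Fin N) :
    E.checkerboard (E.endSegment (Sum.inr i)) = ((i : ℕ) : ZMod 2) := by
  rw [checkerboard, E.balanced_one.segmentParity_endSegment_inr]
  simp [Finset.filter_gt_eq_Iio]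

theorem checkerboard_mirrorSegment (S : E.Segment) :
    E.checkerboard (E.mirrorSegment S) = E.checkerboard S := by
  have hm : (S.left + S.right) / 2 ∈ Icc (-1 : ℝ) 1 :=
    ⟨S.neg_one_le_left.trans S.midpoint_mem.1.le, S.midpoint_mem.2.le.trans S.right_le_one⟩
  have he : (-S.right + -S.left) / 2 = -((S.left + S.right) / 2) := by ring
  simp only [checkerboard, segmentParity, heightParity, mirrorSegment, he, Finset.sum_filter]
  rw [← Equiv.sum_comp π.2.1.toPerm]
  simp [E.mirror _ _ hm]

/-! ### Every strand that is not a loop has two ends -/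

variable {E}

/-- An end of a segment is on the boundary or at a crossing, where the resolution joins it to
exactly one segment. The neighbors at the two ends are distinct because two edges meet at most once.
-/
theorem ncard_neighborSet (σ : E.Uncrossing) (S : E.Segment) :
    ((strandGraph σ).neighborSet S).ncard =
      (if S.right = 1 then 0 else 1) + if S.left = -1 then 0 else 1 := by
  set A := {T | ∃ k, ∃ h : E.MeetAt S.edge k S.right, T = rightNext σ h} with hA
  set B := {T | ∃ k, ∃ h : E.MeetAt S.edge k S.left, T = leftNext σ h} with hB
  have hAB : (strandGraph σ).neighborSet S = A ∪ B := by
    ext T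
    exact strandGraph_adj_iff σ S T
  have hdisj : Disjoint A B := by
    rw [Set.disjoint_left]
    rintro T ⟨k, h, rfl⟩ ⟨k', h', e⟩
    have : k = k' := by simpa using congrArg Segment.edge e
    subst this
    exact S.left_lt_right.ne' (h.eq_abscissa h')
  rw [hAB, Set.ncard_union_eq hdisj (Set.toFinite _) (Set.toFinite _)]
  congr 1
  · split_ifs with h1
    · rw [Set.ncard_eq_zero]
      refine Set.eq_empty_of_forall_notMem ?_
      rintro T ⟨k, h, rfl⟩
      exact h.mem_Ioo.2.ne h1
    · rw [Set.ncard_eq_one]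
      rcases S.isBreak_right with e | e | ⟨k, h⟩
      · exact absurd (S.neg_one_le_left.trans_lt S.left_lt_right) (by rw [e]; exact lt_irrefl _)
      · exact absurd e h1
      · refine ⟨rightNext σ h, Set.eq_singleton_iff_unique_mem.2 ⟨⟨k, h, rfl⟩, ?_⟩⟩
        rintro T ⟨k', h', rfl⟩
        obtain rfl := h.eq_edge h'
        rfl
  · split_ifs with h1
    · rw [Set.ncard_eq_zero]
      refine Set.eq_empty_of_forall_notMem ?_
      rintro T ⟨k, h, rfl⟩
      exact h.mem_Ioo.1.ne' h1
    · rw [Set.ncard_eq_one]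
      rcases S.isBreak_left with e | e | ⟨k, h⟩
      · exact absurd e h1
      · exact absurd (S.left_lt_right.trans_le S.right_le_one) (by rw [e]; exact lt_irrefl _)
      · refine ⟨leftNext σ h, Set.eq_singleton_iff_unique_mem.2 ⟨⟨k, h, rfl⟩, ?_⟩⟩
        rintro T ⟨k', h', rfl⟩
        obtain rfl := h.eq_edge h'
        rfl

theorem ncard_setOf_endSegment_eq (S : E.Segment) :
    {v | E.endSegment v = S}.ncard =
      (if S.right = 1 then 1 else 0) + if S.left = -1 then 1 else 0 := by
  have h : {v | E.endSegment v = S} = (if S.right = 1 then {Sum.inr (π S.edge)} else ∅) ∪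
      (if S.left = -1 then {Sum.inl S.edge} else ∅) := by
    ext v
    rw [Set.mem_ofPred_eq, eq_comm, ← E.isEnd_iff]
    rcases v with i | i
    · simp only [IsEnd]
      split_ifs <;> simp [*, eq_comm]
    · simp only [IsEnd]
      split_ifs <;> simp [*, eq_comm]
  rw [h, Set.ncard_union_eq _ (Set.toFinite _) (Set.toFinite _)]
  · split_ifs <;> simp
  · split_ifs <;> simp

theorem ncard_neighborSet_add_ncard_ends (σ : E.Uncrossing) (S : E.Segment) :
    ((strandGraph σ).neighborSet S).ncard + {v | E.endSegment v = S}.ncard = 2 := by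
  rw [ncard_neighborSet, ncard_setOf_endSegment_eq]
  split_ifs <;> rfl

/-- Degree plus number of boundary ends is 2 at every segment. With `v` segments and `e`
adjacencies, the component thus has `2v - 2e` ends, and connectedness gives `v ≤ e + 1`. -/
theorem ncard_ends_component (σ : E.Uncrossing) (C : (strandGraph σ).ConnectedComponent) :
    {v | E.endSegment v ∈ C}.ncard = 0 ∨ {v | E.endSegment v ∈ C}.ncard = 2 := by
  classical
  have : Fintype E.Segment := Fintype.ofFinite _
  have : Fintype C := Fintype.ofFinite _
  have hdeg : ∀ u : C, C.toSimpleGraph.degree u = ((strandGraph σ).neighborSet u.1).ncard := by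
    intro u
    rw [← SimpleGraph.card_neighborSet_eq_degree, ← Nat.card_eq_fintype_card,
      Nat.card_coe_set_eq, ← Set.ncard_image_of_injective _ Subtype.val_injective]
    congr 1
    ext T
    constructor
    · rintro ⟨w, hw, rfl⟩
      exact hw
    · intro hT
      exact ⟨⟨T, C.mem_supp_of_adj_mem_supp u.2 hT⟩, hT, rfl⟩
  have hends : {v | E.endSegment v ∈ C}.ncard =
      ∑ u : C, {v | E.endSegment v = u.1}.ncard := by
    have h1 : {v | E.endSegment v ∈ C}.ncard =
        (Finset.univ.filter fun v => E.endSegment v ∈ C).card := by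
      rw [← Set.ncard_coe_finset]; simp
    rw [h1, Finset.card_eq_sum_card_fiberwise (f := E.endSegment)
      (t := Finset.univ.filter fun S => S ∈ C) (by intro v; simp)]
    rw [Finset.sum_subtype (p := fun S => S ∈ C.supp) _ fun S => by
      simp only [Finset.mem_filter, Finset.mem_univ, true_and]; rfl]
    refine Finset.sum_congr rfl fun u _ => ?_
    rw [← Set.ncard_coe_finset]
    congr 1
    ext v
    simp only [Finset.coe_filter, Finset.mem_filter, Finset.mem_univ, true_and, mem_ofPred_eq]
    exact ⟨fun h => h.2, fun h => ⟨h ▸ u.2, h⟩⟩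
  have hsum : 2 * C.toSimpleGraph.edgeFinset.card + {v | E.endSegment v ∈ C}.ncard =
      2 * Fintype.card C := by
    rw [← SimpleGraph.sum_degrees_eq_twice_card_edges, hends, ← Finset.sum_add_distrib]
    simp only [hdeg, ncard_neighborSet_add_ncard_ends]
    simp [mul_comm]
  have hconn := C.connected_toSimpleGraph.card_vert_le_card_edgeSet_add_one
  rw [Nat.card_eq_fintype_card, Nat.card_eq_fintype_card, ← SimpleGraph.edgeFinset_card] at hconn
  omega

end NiceEmbedding

/-! ### Noncrossing matchings of the boundary vertices -/

theorem boundaryPos_lt {N : ℕ} (v : Vertex N) : boundaryPos v < 2 * N := by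
  rcases v with i | i <;> simp only [boundaryPos] <;> have := i.2 <;> omega

theorem boundaryPos_injective {N : ℕ} : Function.Injective (boundaryPos (N := N)) := by
  rintro (i | i) (j | j) h <;> simp only [boundaryPos] at h <;> have := i.2 <;> have := j.2
  · rw [Fin.ext h]
  · omega
  · omega
  · rw [Fin.ext (a := i) (b := j) (by omega)]

theorem exists_boundaryPos_eq {N m : ℕ} (hm : m < 2 * N) : ∃ v : Vertex N, boundaryPos v = m := by
  by_cases h : m < N
  · exact ⟨Sum.inl ⟨m, h⟩, rfl⟩
  · exact ⟨Sum.inr ⟨2 * N - 1 - m, by omega⟩, by simp only [boundaryPos]; omega⟩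

/-- The vertices strictly between the two ends of an edge are matched among themselves, so their
number is even. -/
theorem IsNoncrossing.odd_boundaryPos_add {N : ℕ} {D : Matching (Vertex N)}
    (hD : IsNoncrossing D) (v : Vertex N) : Odd (boundaryPos v + boundaryPos (D v)) := by
  classical
  wlog hlt : boundaryPos v < boundaryPos (D v) generalizing v
  · have hne : boundaryPos v ≠ boundaryPos (D v) := fun e =>
      D.2.2 v (boundaryPos_injective e).symm
    have := this (D v) (by rw [D.2.1]; omega)
    rwa [D.2.1, add_comm] at this
  let B : Finset (Vertex N) :=
    Finset.univ.filter fun w => boundaryPos v < boundaryPos w ∧ boundaryPos w < boundaryPos (D v)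
  have hcard : B.card = boundaryPos (D v) - boundaryPos v - 1 := by
    rw [← Nat.card_Ioo, ← Finset.card_image_of_injective B boundaryPos_injective]
    congr 1
    ext m
    simp only [B, Finset.mem_image, Finset.mem_filter, Finset.mem_univ, true_and, Finset.mem_Ioo]
    constructor
    · rintro ⟨w, hw, rfl⟩
      exact hw
    · intro hm
      obtain ⟨w, rfl⟩ := exists_boundaryPos_eq (hm.2.trans (boundaryPos_lt _))
      exact ⟨w, hm, rfl⟩
  have heven : (B.card : ZMod 2) = 0 := by
    rw [Finset.card_eq_sum_ones, Nat.cast_sum]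
    refine Finset.sum_involution (fun w _ => D w) (fun w _ => by decide) (fun w _ _ => D.2.2 w)
      (fun w hw => ?_) (fun w _ => D.2.1 w)
    simp only [B, Finset.mem_filter, Finset.mem_univ, true_and] at hw ⊢
    have h1 : boundaryPos (D w) ≠ boundaryPos v := fun e => by
      have := boundaryPos_injective e
      rw [← this, D.2.1] at hw
      omega
    have h2 : boundaryPos (D w) ≠ boundaryPos (D v) := fun e => by
      have := D.2.1.injective (boundaryPos_injective e)
      rw [this] at hw
      omega
    by_contra hcon
    by_cases h3 : boundaryPos (D v) < boundaryPos (D w)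
    · exact hD ⟨v, w, hw.1, hw.2, h3⟩
    · exact hD ⟨D w, v, by omega, by rw [D.2.1]; omega, by rw [D.2.1]; omega⟩
  rw [ZMod.natCast_eq_zero_iff_even, hcard] at heven
  have : boundaryPos v + boundaryPos (D v) =
      (boundaryPos (D v) - boundaryPos v - 1) + (2 * boundaryPos v + 1) := by omega
  rw [this]
  exact heven.add_odd (odd_two_mul_add_one _)

/-- `1` if the two vertices are on the same side and the first one is above the second one. -/
def aboveIndicator {N : ℕ} : Vertex N → Vertex N → ZMod 2
  | Sum.inl j, Sum.inl i => if j < i then 1 else 0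
  | Sum.inr j, Sum.inr i => if j < i then 1 else 0
  | _, _ => 0

/-- The parity of the number of ends of a chord above a boundary vertex, on that vertex's own side
of the rectangle, tells which side of the chord the vertex is on. Interlacing puts `w` and `w'` on
different sides of the chord from `v` to `v'`. -/
theorem aboveIndicator_of_crossing {N : ℕ} {v w v' w' : Vertex N}
    (h1 : boundaryPos v < boundaryPos w) (h2 : boundaryPos w < boundaryPos v')
    (h3 : boundaryPos v' < boundaryPos w') :
    aboveIndicator v w + aboveIndicator v' w ≠ aboveIndicator v w' + aboveIndicator v' w' := by
  rcases v with i | i <;> rcases w with j | j <;> rcases v' with k | k <;> rcases w' with l | l <;>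
    simp only [boundaryPos] at h1 h2 h3 <;>
    have := i.2 <;> have := j.2 <;> have := k.2 <;> have := l.2 <;>
    simp only [aboveIndicator, Fin.lt_def] <;>
    first
    | (exfalso; omega)
    | (split_ifs <;> first | (exfalso; omega) | decide)

theorem sum_pair_indicator {N : ℕ} {v v' : Vertex N} (hne : v ≠ v') (f : Fin N → Vertex N)
    (hf : f = Sum.inl ∨ f = Sum.inr) (i : Fin N) (g : Vertex N → ZMod 2)
    (hg : ∀ w, g w = if w = v ∨ w = v' then 1 else 0) :
    ∑ j with j < i, g (f j) = aboveIndicator v (f i) + aboveIndicator v' (f i) := by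
  have hg' : ∀ w, g w = (if w = v then 1 else 0) + if w = v' then 1 else 0 := by
    intro w
    rw [hg]
    by_cases h1 : w = v
    · subst h1; simp [hne]
    · simp [h1]
  have key : ∀ u, ∑ j with j < i, (if f j = u then (1 : ZMod 2) else 0) =
      aboveIndicator u (f i) := by
    rintro (k | k) <;> rcases hf with rfl | rfl <;> simp [aboveIndicator]
  simp only [hg', Finset.sum_add_distrib, key]

namespace NiceEmbedding

variable {N : ℕ} {π : Matching (Fin N)} {E : NiceEmbedding π}

/-! ### The diagram of an uncrossing -/

theorem existsUnique_other_end (σ : E.Uncrossing) (v : Vertex N) :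
    ∃! w, w ≠ v ∧ (strandGraph σ).Reachable (E.endSegment v) (E.endSegment w) := by
  set C := (strandGraph σ).connectedComponentMk (E.endSegment v) with hC
  have hmem : ∀ w, w ∈ {w | E.endSegment w ∈ C} ↔
      (strandGraph σ).Reachable (E.endSegment v) (E.endSegment w) := fun w => by
    rw [hC, Set.mem_ofPred_eq]
    exact SimpleGraph.ConnectedComponent.eq.trans ⟨SimpleGraph.Reachable.symm, SimpleGraph.Reachable.symm⟩
  have hv := (hmem v).2 (SimpleGraph.Reachable.refl _)
  rcases ncard_ends_component σ C with h | h
  · rw [Set.ncard_eq_zero] at h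
    rw [h] at hv
    exact absurd hv (Set.notMem_empty _)
  · obtain ⟨a, b, hab, hs⟩ := Set.ncard_eq_two.1 h
    simp only [← hmem, hs] at hv ⊢
    rcases hv with rfl | rfl
    · exact ⟨b, ⟨hab.symm, by simp⟩, fun w hw => by simpa [hw.1] using hw.2⟩
    · exact ⟨a, ⟨hab, by simp⟩, fun w hw => by simpa [hw.1] using hw.2⟩

/-- The diagram of an uncrossing joins the two ends of each strand that is not a loop. -/
def diagram (σ : E.Uncrossing) : Matching (Vertex N) :=
  ⟨fun v => (existsUnique_other_end σ v).choose, fun v => by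
    have h := (existsUnique_other_end σ v).choose_spec.1
    exact ((existsUnique_other_end σ _).choose_spec.2 v ⟨h.1.symm, h.2.symm⟩).symm,
    fun v => (existsUnique_other_end σ v).choose_spec.1.1⟩

theorem reachable_diagram (σ : E.Uncrossing) (v : Vertex N) :
    (strandGraph σ).Reachable (E.endSegment v) (E.endSegment (diagram σ v)) :=
  (existsUnique_other_end σ v).choose_spec.1.2

theorem reachable_endSegment_iff (σ : E.Uncrossing) (v w : Vertex N) :
    (strandGraph σ).Reachable (E.endSegment v) (E.endSegment w) ↔ w = v ∨ w = diagram σ v := by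
  constructor
  · intro h
    by_cases hwv : w = v
    · exact Or.inl hwv
    · exact Or.inr ((existsUnique_other_end σ v).choose_spec.2 w ⟨hwv, h⟩)
  · rintro (rfl | rfl)
    · exact SimpleGraph.Reachable.refl _
    · exact reachable_diagram σ v

theorem hasDiagram_iff (σ : E.Uncrossing) (D : Matching (Vertex N)) :
    HasDiagram σ D ↔ D = diagram σ := by
  simp only [HasDiagram, E.isEnd_iff]
  constructor
  · intro h
    refine Subtype.ext (funext fun v => ?_)
    obtain ⟨S, T, rfl, rfl, hST⟩ := h v
    exact ((reachable_endSegment_iff σ _ _).1 hST).resolve_left (D.2.2 v)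
  · rintro rfl v
    exact ⟨_, _, rfl, rfl, reachable_diagram σ v⟩

theorem adj_mirrorSegment (σ : E.Uncrossing) {S T : E.Segment} (h : (strandGraph σ).Adj S T) :
    (strandGraph σ).Adj (E.mirrorSegment S) (E.mirrorSegment T) := by
  obtain ⟨c, x, hc, hm, hr⟩ := h
  refine ⟨E.mirrorCrossing c, -x, ?_, E.meetAt_mirror hm, ?_⟩
  · simp [mirrorCrossing, hc, mirrorSegment]
  · rw [σ.2 c]
    revert hr
    cases σ.1 c <;> simp only [mirrorSegment, neg_inj] <;> tauto

theorem reachable_mirrorSegment (σ : E.Uncrossing) {S T : E.Segment}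
    (h : (strandGraph σ).Reachable S T) :
    (strandGraph σ).Reachable (E.mirrorSegment S) (E.mirrorSegment T) := by
  obtain ⟨p⟩ := h
  induction p with
  | nil => exact SimpleGraph.Reachable.refl _
  | cons hadj _ ih => exact (adj_mirrorSegment σ hadj).reachable.trans ih

theorem isMirrorSymmetric_diagram (σ : E.Uncrossing) : IsMirrorSymmetric (diagram σ) := by
  intro v
  have h := reachable_mirrorSegment σ (reachable_diagram σ v)
  rw [mirrorSegment_endSegment, mirrorSegment_endSegment] at h
  have hne : (diagram σ v).swap ≠ v.swap := fun e =>
    (diagram σ).2.2 v (Sum.swap_leftInverse.injective e)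
  exact (((reachable_endSegment_iff σ _ _).1 h).resolve_left hne).symm

theorem segmentParity_strand (σ : E.Uncrossing) (v w : Vertex N) {g : E.Segment → ZMod 2}
    (hb : E.Balanced g)
    (hg : ∀ u, g (E.endSegment u) = if u = v ∨ u = diagram σ v then 1 else 0) :
    segmentParity g (E.endSegment w) = aboveIndicator v w + aboveIndicator (diagram σ v) w := by
  have hne := ((diagram σ).2.2 v).symm
  rcases w with i | i
  · rw [hb.segmentParity_endSegment_inl]
    exact sum_pair_indicator hne Sum.inl (Or.inl rfl) i (fun u => g (E.endSegment u)) hg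
  · rw [hb.segmentParity_endSegment_inr]
    exact sum_pair_indicator hne Sum.inr (Or.inr rfl) i (fun u => g (E.endSegment u)) hg

/-- A Jordan curve argument modulo 2: with `g` the indicator of the strand through `v`, the parity
above is constant along the strand through `w`, but takes different values at the ends of an
interlacing chord. -/
theorem isNoncrossing_diagram (σ : E.Uncrossing) : IsNoncrossing (diagram σ) := by
  classical
  rintro ⟨v, w, h1, h2, h3⟩
  let g : E.Segment → ZMod 2 := fun S =>
    if (strandGraph σ).Reachable (E.endSegment v) S then 1 else 0
  have hg : StrandInvariant σ g := by
    intro S T h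
    have : (strandGraph σ).Reachable (E.endSegment v) S ↔
        (strandGraph σ).Reachable (E.endSegment v) T :=
      ⟨fun h' => h'.trans h.reachable, fun h' => h'.trans h.symm.reachable⟩
    simp only [g, this]
  have hge : ∀ u, g (E.endSegment u) = if u = v ∨ u = diagram σ v then 1 else 0 := fun u => by
    simp only [g, reachable_endSegment_iff]
  have hw : g (E.endSegment w) = 0 := by
    rw [hge, if_neg]
    rintro (rfl | rfl)
    · exact lt_irrefl _ h1
    · exact lt_irrefl _ h2
  have := hg.segmentParity_eq_of_reachable (reachable_diagram σ w) hw
  rw [segmentParity_strand σ v w hg.balanced hge, segmentParity_strand σ v _ hg.balanced hge] at this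
  exact aboveIndicator_of_crossing h1 h2 h3 this

end NiceEmbedding

/-- The label of the end segments given by `I`: `1` on `I`, on both sides. -/
def boundaryLabel {N : ℕ} (I : Finset (Fin N)) : Vertex N → ZMod 2
  | Sum.inl i => if i ∈ I then 1 else 0
  | Sum.inr i => if i ∈ I then 1 else 0

theorem boundaryLabel_swap {N : ℕ} (I : Finset (Fin N)) (v : Vertex N) :
    boundaryLabel I v.swap = boundaryLabel I v := by
  rcases v with i | i <;> rfl

namespace NiceEmbedding

variable {N : ℕ} {π : Matching (Fin N)} {E : NiceEmbedding π}

/-! ### Counting the colorings consistent with an uncrossing -/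

/-- On the right side black means outside `I`, and the boundary position of `i'` has the parity of
`i + 1`; the two changes cancel. -/
theorem boundaryLabel_add_checkerboard (E : NiceEmbedding π) (I : Finset (Fin N)) (v : Vertex N)
    [Decidable (IsBlack I v)] :
    boundaryLabel I v + E.checkerboard (E.endSegment v) =
      (if IsBlack I v then 1 else 0) + (boundaryPos v : ZMod 2) := by
  rcases v with i | i
  · rw [E.checkerboard_endSegment_inl]
    by_cases hi : i ∈ I <;> simp [boundaryLabel, boundaryPos, IsBlack, hi]
  · have h : ((boundaryPos (Sum.inr i) : ℕ) : ZMod 2) = (i : ℕ) + 1 := by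
      have h2 : boundaryPos (Sum.inr i) + ((i : ℕ) + 1) = 2 * N := by
        simp only [boundaryPos]
        have := i.2
        omega
      have h3 := congrArg (Nat.cast : ℕ → ZMod 2) h2
      push_cast at h3
      rw [show (2 : ZMod 2) = 0 from rfl, zero_mul] at h3
      exact CharTwo.add_eq_zero.1 h3
    rw [E.checkerboard_endSegment_inr, h]
    generalize ((i : ℕ) : ZMod 2) = x
    by_cases hi : i ∈ I <;>
      simp only [boundaryLabel, IsBlack, hi, not_true, not_false_iff, if_true, if_false] <;>
      revert x <;> decide

/-- The ends of an edge of a noncrossing matching have positions of opposite parity, so their colors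
differ exactly when color plus position agrees. -/
theorem isCompatible_iff (E : NiceEmbedding π) (I : Finset (Fin N)) {D : Matching (Vertex N)}
    (hD : IsNoncrossing D) :
    IsCompatible I D ↔ ∀ v, boundaryLabel I v + E.checkerboard (E.endSegment v) =
      boundaryLabel I (D v) + E.checkerboard (E.endSegment (D v)) := by
  classical
  refine forall_congr' fun v => ?_
  have h := hD.odd_boundaryPos_add v
  rw [← ZMod.natCast_eq_one_iff_odd, Nat.cast_add] at h
  rw [boundaryLabel_add_checkerboard, boundaryLabel_add_checkerboard]
  generalize (boundaryPos v : ZMod 2) = x at *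
  generalize (boundaryPos (D v) : ZMod 2) = y at *
  by_cases h1 : IsBlack I v <;> by_cases h2 : IsBlack I (D v) <;>
    simp only [h1, h2, if_true, if_false, iff_true, iff_false, not_true, not_false_iff,
      true_iff, false_iff] <;> revert x y <;> decide

/-- The component of a segment in the uncrossed graph. -/
def strand (σ : E.Uncrossing) (S : E.Segment) : Set E.Segment :=
  ((strandGraph σ).connectedComponentMk S).supp

theorem mem_strand_iff {σ : E.Uncrossing} {S T : E.Segment} :
    T ∈ strand σ S ↔ (strandGraph σ).Reachable T S :=
  SimpleGraph.ConnectedComponent.eq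

theorem strand_eq_iff {σ : E.Uncrossing} {S T : E.Segment} :
    strand σ S = strand σ T ↔ (strandGraph σ).Reachable S T := by
  constructor
  · intro h
    rw [← mem_strand_iff, ← h, mem_strand_iff]
  · intro h
    ext U
    simp only [mem_strand_iff]
    exact ⟨fun h' => h'.trans h, fun h' => h'.trans h.symm⟩

theorem mirror_strand (σ : E.Uncrossing) (S : E.Segment) :
    {T | ∃ U ∈ strand σ S, E.IsMirror U T} = strand σ (E.mirrorSegment S) := by
  ext T
  simp only [E.isMirror_iff, Set.mem_ofPred_eq, mem_strand_iff]
  constructor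
  · rintro ⟨U, hU, rfl⟩
    exact reachable_mirrorSegment σ hU
  · intro h
    refine ⟨E.mirrorSegment T, ?_, (E.mirrorSegment_mirrorSegment T).symm⟩
    simpa only [E.mirrorSegment_mirrorSegment] using reachable_mirrorSegment σ h

/-- The strand of a segment together with its mirror image. -/
def strandPair (σ : E.Uncrossing) (S : E.Segment) : Set (Set E.Segment) :=
  {strand σ S, strand σ (E.mirrorSegment S)}

theorem strandPair_mirrorSegment (σ : E.Uncrossing) (S : E.Segment) :
    strandPair σ (E.mirrorSegment S) = strandPair σ S := by
  rw [strandPair, strandPair, E.mirrorSegment_mirrorSegment, Set.pair_comm]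

theorem strandPair_eq_of_reachable {σ : E.Uncrossing} {S T : E.Segment}
    (h : (strandGraph σ).Reachable S T) : strandPair σ S = strandPair σ T := by
  rw [strandPair, strandPair, strand_eq_iff.2 h, strand_eq_iff.2 (reachable_mirrorSegment σ h)]

theorem reachable_of_strandPair_eq {σ : E.Uncrossing} {S T : E.Segment}
    (h : strandPair σ S = strandPair σ T) :
    (strandGraph σ).Reachable S T ∨ (strandGraph σ).Reachable S (E.mirrorSegment T) := by
  have : strand σ S ∈ strandPair σ T := by rw [← h]; simp [strandPair]
  rcases this with h | h
  · exact Or.inl (strand_eq_iff.1 h)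
  · exact Or.inr (strand_eq_iff.1 h)

theorem isLoop_strand_iff {σ : E.Uncrossing} {S : E.Segment} :
    IsLoop σ (strand σ S) ↔ ∀ v, ¬ (strandGraph σ).Reachable S (E.endSegment v) := by
  simp only [IsLoop, E.isEnd_iff, mem_strand_iff]
  constructor
  · rintro ⟨-, h⟩ v hv
    exact h _ hv.symm v rfl
  · rintro h
    refine ⟨⟨_, rfl⟩, fun T hT v e => h v ?_⟩
    rw [← e]
    exact hT.symm

theorem loopNumber_eq (σ : E.Uncrossing) :
    loopNumber σ = {P | ∃ S, IsLoop σ (strand σ S) ∧ P = strandPair σ S}.ncard := by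
  unfold loopNumber
  congr 1
  ext P
  constructor
  · rintro ⟨L, hL, rfl⟩
    obtain ⟨C, rfl⟩ := hL.1
    induction C using SimpleGraph.ConnectedComponent.ind with
    | h S => exact ⟨S, hL, by rw [strandPair, ← mirror_strand]; rfl⟩
  · rintro ⟨S, hS, rfl⟩
    exact ⟨_, hS, by rw [mirror_strand]; rfl⟩

/-- The number of mirror symmetric labels, constant along strands, with given values at the
boundary. -/
theorem ncard_labels (σ : E.Uncrossing) (b : Vertex N → ZMod 2)
    (hswap : ∀ v, b v.swap = b v) (hb : ∀ v, b v = b (diagram σ v)) :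
    {g : E.Segment → ZMod 2 | (∀ S, g (E.mirrorSegment S) = g S) ∧ StrandInvariant σ g ∧
      ∀ v, g (E.endSegment v) = b v}.ncard = 2 ^ loopNumber σ := by
  classical
  set K := {g : E.Segment → ZMod 2 | (∀ S, g (E.mirrorSegment S) = g S) ∧ StrandInvariant σ g ∧
      ∀ v, g (E.endSegment v) = b v} with hK
  set Λ := {P | ∃ S, IsLoop σ (strand σ S) ∧ P = strandPair σ S} with hΛ
  -- The value of a label at one chosen segment of each loop pair is its free bit.
  have hrep : ∀ P : Λ, ∃ S, IsLoop σ (strand σ S) ∧ P.1 = strandPair σ S := fun P => P.2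
  choose rep hloop hrep using hrep
  have hbij : Function.Bijective fun (g : K) (P : Λ) => g.1 (rep P) := by
    constructor
    · rintro ⟨g, gm, gi, gb⟩ ⟨g', gm', gi', gb'⟩ h
      refine Subtype.ext (funext fun S => ?_)
      simp only
      by_cases hS : IsLoop σ (strand σ S)
      · have h1 := congrFun h ⟨strandPair σ S, S, hS, rfl⟩
        simp only at h1
        rcases reachable_of_strandPair_eq (hrep ⟨strandPair σ S, S, hS, rfl⟩) with h2 | h2
        · rw [gi.eq_of_reachable h2, h1, gi'.eq_of_reachable h2]
        · rw [gi.eq_of_reachable h2, gm, h1, gi'.eq_of_reachable h2, gm']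
      · rw [isLoop_strand_iff] at hS
        push Not at hS
        obtain ⟨v, hv⟩ := hS
        rw [gi.eq_of_reachable hv, gi'.eq_of_reachable hv, gb, gb']
    · intro f
      have hend : ∀ S, ¬ IsLoop σ (strand σ S) →
          ∃ v, (strandGraph σ).Reachable S (E.endSegment v) := fun S hS => by
        rw [isLoop_strand_iff] at hS
        push Not at hS
        exact hS
      have hbr : ∀ v w, (strandGraph σ).Reachable (E.endSegment v) (E.endSegment w) →
          b v = b w := fun v w h => by
        rcases (reachable_endSegment_iff σ v w).1 h with rfl | rfl
        · rfl
        · exact hb v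
      -- On a loop, the bit of its pair; elsewhere, the value at either end of the strand, the two
      -- being equal by `hb`.
      let g : E.Segment → ZMod 2 := fun S =>
        if h : IsLoop σ (strand σ S) then f ⟨strandPair σ S, S, h, rfl⟩
        else b (hend S h).choose
      have g_loop : ∀ S (h : IsLoop σ (strand σ S)) P, P.1 = strandPair σ S → g S = f P := by
        intro S h P hP
        simp only [g, dif_pos h]
        congr 1
        exact Subtype.ext hP.symm
      have g_end : ∀ S v, (strandGraph σ).Reachable S (E.endSegment v) → g S = b v := by
        intro S v hv
        have h : ¬ IsLoop σ (strand σ S) := fun h => isLoop_strand_iff.1 h v hv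
        simp only [g, dif_neg h]
        exact hbr _ _ ((hend S h).choose_spec.symm.trans hv)
      refine ⟨⟨g, fun S => ?_, fun S T hST => ?_, fun v => ?_⟩, ?_⟩
      · by_cases h : IsLoop σ (strand σ S)
        · have h' : IsLoop σ (strand σ (E.mirrorSegment S)) := by
            rw [isLoop_strand_iff] at h ⊢
            intro v hv
            have := reachable_mirrorSegment σ hv
            rw [E.mirrorSegment_mirrorSegment, E.mirrorSegment_endSegment] at this
            exact h _ this
          rw [g_loop S h ⟨_, S, h, rfl⟩ rfl,
            g_loop _ h' ⟨_, S, h, rfl⟩ (strandPair_mirrorSegment σ S).symm]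
        · obtain ⟨v, hv⟩ := hend S h
          have := reachable_mirrorSegment σ hv
          rw [E.mirrorSegment_endSegment] at this
          rw [g_end S v hv, g_end _ _ this, hswap]
      · by_cases h : IsLoop σ (strand σ S)
        · have h' : IsLoop σ (strand σ T) := by
            rwa [← strand_eq_iff.2 hST.reachable]
          rw [g_loop S h ⟨_, S, h, rfl⟩ rfl,
            g_loop T h' ⟨_, S, h, rfl⟩ (strandPair_eq_of_reachable hST.reachable)]
        · obtain ⟨v, hv⟩ := hend S h
          rw [g_end S v hv, g_end T v (hST.symm.reachable.trans hv)]
      · exact g_end _ v (SimpleGraph.Reachable.refl _)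
      · funext P
        exact g_loop _ (hloop P) P (hrep P)
  rw [loopNumber_eq, ← hΛ, ← Nat.card_coe_set_eq, ← Nat.card_coe_set_eq,
    Nat.card_congr (Equiv.ofBijective _ hbij), Nat.card_fun, Nat.card_zmod]

variable (E) in
/-- A mirror symmetric coloring of the segments with the boundary values given by `I`. -/
structure IsColoring (I : Finset (Fin N)) (c : E.Segment → ZMod 2) : Prop where
  mirror : ∀ S, c (E.mirrorSegment S) = c S
  boundary : ∀ v, c (E.endSegment v) = boundaryLabel I v

variable (E) in
/-- The coloring `c` is consistent with the uncrossing `σ` if it differs from the checkerboard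
coloring by a label that is constant along strands. -/
def IsConsistent (σ : E.Uncrossing) (c : E.Segment → ZMod 2) : Prop :=
  StrandInvariant σ fun S => c S + E.checkerboard S

-- Adding the checkerboard is a bijection onto the labels of `ncard_labels`; compatibility says that
-- the prescribed values agree at the two ends of each strand.
open Classical in
theorem ncard_colorings (σ : E.Uncrossing) (I : Finset (Fin N)) :
    {c | E.IsColoring I c ∧ E.IsConsistent σ c}.ncard =
      if IsCompatible I (diagram σ) then 2 ^ loopNumber σ else 0 := by
  have hcompat := isCompatible_iff E I (isNoncrossing_diagram σ)
  split_ifs with h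
  · rw [← ncard_labels σ (fun v => boundaryLabel I v + E.checkerboard (E.endSegment v))
      (fun v => by
        rw [boundaryLabel_swap, ← E.mirrorSegment_endSegment, E.checkerboard_mirrorSegment])
      (hcompat.1 h)]
    rw [← Set.ncard_image_of_injective _ (f := fun (c : E.Segment → ZMod 2) S =>
      c S + E.checkerboard S) fun c c' h => funext fun S => add_right_cancel (congrFun h S)]
    congr 1
    ext g
    constructor
    · rintro ⟨c, ⟨hc, hcons⟩, rfl⟩
      exact ⟨fun S => by simp only [hc.mirror, E.checkerboard_mirrorSegment], hcons,
        fun v => by simp only [hc.boundary]⟩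
    · rintro ⟨gm, gi, gb⟩
      refine ⟨fun S => g S + E.checkerboard S, ⟨⟨fun S => ?_, fun v => ?_⟩, ?_⟩, ?_⟩
      · simp only [gm, E.checkerboard_mirrorSegment]
      · simp only [gb, add_assoc, CharTwo.add_self_eq_zero, add_zero]
      · simpa only [IsConsistent, add_assoc, CharTwo.add_self_eq_zero, add_zero] using gi
      · simp only [add_assoc, CharTwo.add_self_eq_zero, add_zero]
  · rw [Set.ncard_eq_zero]
    refine Set.eq_empty_of_forall_notMem ?_
    rintro c ⟨hc, hcons⟩
    refine h (hcompat.2 fun v => ?_)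
    rw [← hc.boundary, ← hc.boundary]
    exact hcons.eq_of_reachable (reachable_diagram σ v)

end NiceEmbedding

namespace NiceEmbedding

variable {N : ℕ} {π : Matching (Fin N)} {E : NiceEmbedding π}

/-! ### Uncrossings as independent choices, and the factorization of the weights -/

theorem Resolution.forall_iff {p : Resolution → Prop} :
    (∀ s, p s) ↔ p .vertical ∧ p .horizontal :=
  ⟨fun h => ⟨h _, h _⟩, fun h s => match s with
    | .vertical => h.1
    | .horizontal => h.2⟩

instance : DecidableEq Resolution
  | .vertical, .vertical => isTrue rfl
  | .horizontal, .horizontal => isTrue rfl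
  | .vertical, .horizontal => isFalse Resolution.noConfusion
  | .horizontal, .vertical => isFalse Resolution.noConfusion

instance : Fintype Resolution :=
  ⟨{.vertical, .horizontal}, Resolution.forall_iff.2 ⟨by simp, by simp⟩⟩

theorem Resolution.sum_univ {M : Type*} [AddCommMonoid M] (f : Resolution → M) :
    ∑ s, f s = f .vertical + f .horizontal :=
  Finset.sum_pair (by simp)

/-! ### Crossings modulo the reflection. -/

theorem isUnpaired_crossing_iff {i k : Fin N} {t : ℝ} (h : E.MeetAt i k t) :
    E.IsUnpaired (E.crossing h) ↔ k = π i := by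
  constructor
  · rintro ⟨j, hj⟩
    rcases Sym2.eq_iff.1 hj with ⟨rfl, rfl⟩ | ⟨rfl, rfl⟩
    · rfl
    · exact (π.2.1 _).symm
  · rintro rfl
    exact ⟨i, rfl⟩

theorem exists_eq_crossing (q : E.Crossing) :
    ∃ i k t, ∃ h : E.MeetAt i k t, q = E.crossing h := by
  obtain ⟨_, i, k, t, rfl, h⟩ := q
  exact ⟨i, k, t, h, rfl⟩

theorem IsUnpaired.mirrorCrossing_eq {q : E.Crossing} (h : E.IsUnpaired q) :
    E.mirrorCrossing q = q := by
  obtain ⟨i, hi⟩ := h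
  apply Subtype.ext
  simp only [mirrorCrossing, hi, Sym2.map_mk, π.2.1 i]
  exact Sym2.eq_swap

theorem isUnpaired_mirrorCrossing_iff {q : E.Crossing} :
    E.IsUnpaired (E.mirrorCrossing q) ↔ E.IsUnpaired q := by
  constructor
  · intro h
    have := h.mirrorCrossing_eq
    rw [E.mirrorCrossing_mirrorCrossing] at this
    rwa [this]
  · intro h
    rwa [h.mirrorCrossing_eq]

/-- In each mirror symmetric pair of crossings, the one that involves the smallest edge. -/
def IsRepresentative (q : E.Crossing) : Prop := q.1.inf ≤ (E.mirrorCrossing q).1.inf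

theorem isRepresentative_or (q : E.Crossing) :
    IsRepresentative q ∨ IsRepresentative (E.mirrorCrossing q) := by
  unfold IsRepresentative
  rw [E.mirrorCrossing_mirrorCrossing]
  exact le_total _ _

/-- In a tie, the least edge belongs both to `{i, k}` and to `{π i, π k}`. Since `π` has no fixed
point, this forces `k = π i`, an unpaired crossing. -/
theorem mirrorCrossing_eq_of_isRepresentative {q : E.Crossing} (h1 : IsRepresentative q)
    (h2 : IsRepresentative (E.mirrorCrossing q)) : E.mirrorCrossing q = q := by
  unfold IsRepresentative at h1 h2
  rw [E.mirrorCrossing_mirrorCrossing] at h2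
  have h := le_antisymm h1 h2
  obtain ⟨i, k, t, hm, rfl⟩ := exists_eq_crossing q
  refine IsUnpaired.mirrorCrossing_eq ((isUnpaired_crossing_iff hm).2 ?_)
  simp only [mirrorCrossing, crossing, Sym2.map_mk, Sym2.inf_mk] at h
  have hi := π.2.2 i
  have hk := π.2.2 k
  have hki : π k = i → k = π i := fun e => by rw [← e, π.2.1]
  rcases min_choice i k with e1 | e1 <;> rcases min_choice (π i) (π k) with e2 | e2 <;>
    rw [e1, e2] at h
  · exact absurd h.symm hi
  · exact hki h.symm
  · exact h
  · exact absurd h.symm hk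

theorem IsUnpaired.isRepresentative {q : E.Crossing} (h : E.IsUnpaired q) :
    IsRepresentative q := by
  unfold IsRepresentative
  rw [h.mirrorCrossing_eq]

variable (E) in
/-- Representatives of the crossings modulo the mirror symmetry. -/
abbrev Representative := {q : E.Crossing // IsRepresentative q}

variable (E) in
open Classical in
/-- An uncrossing is given by independent choices at the representatives. -/
def uncrossingEquiv : E.Uncrossing ≃ (E.Representative → Resolution) where
  toFun σ r := σ.1 r.1
  invFun ρ := ⟨fun q => if h : IsRepresentative q then ρ ⟨q, h⟩ else
      ρ ⟨E.mirrorCrossing q, (isRepresentative_or q).resolve_left h⟩, fun q => by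
    by_cases h1 : IsRepresentative q <;> by_cases h2 : IsRepresentative (E.mirrorCrossing q)
    · simp only [dif_pos h1, dif_pos h2]
      congr 2
      exact mirrorCrossing_eq_of_isRepresentative h1 h2
    · simp only [dif_pos h1, dif_neg h2]
      congr 2
      exact E.mirrorCrossing_mirrorCrossing q
    · simp only [dif_neg h1, dif_pos h2]
    · exact absurd (isRepresentative_or q) (not_or.2 ⟨h1, h2⟩)⟩
  left_inv σ := by
    refine Subtype.ext (funext fun q => ?_)
    simp only
    split_ifs with h
    · rfl
    · exact σ.2 q
  right_inv ρ := by
    funext r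
    simp only [dif_pos r.2]

instance : Finite E.Crossing := inferInstanceAs (Finite (Subtype _))

instance : Fintype E.Representative := Fintype.ofFinite _

open Classical in
/-- The contribution of a crossing, or of a pair of crossings, to the sign of the weight. -/
def localSign (q : E.Crossing) (s : Resolution) : ℤ :=
  if E.IsUnpaired q then (if s = .vertical then -1 else 1)
  else (if s = .horizontal then -1 else 1)

theorem unpairedVertical_eq (σ : E.Uncrossing) :
    unpairedVertical σ =
      {r : E.Representative | E.IsUnpaired r.1 ∧ σ.1 r.1 = .vertical}.ncard := by
  unfold unpairedVertical
  rw [← Set.ncard_image_of_injective (f := (Subtype.val : E.Representative → E.Crossing)) _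
    Subtype.val_injective]
  congr 1
  ext q
  constructor
  · rintro ⟨h1, h2⟩
    exact ⟨⟨q, h1.isRepresentative⟩, ⟨h1, h2⟩, rfl⟩
  · rintro ⟨r, h, rfl⟩
    exact h

/-- Every mirror pair contains exactly one representative. -/
theorem pairedHorizontal_eq (σ : E.Uncrossing) :
    pairedHorizontal σ =
      {r : E.Representative | ¬ E.IsUnpaired r.1 ∧ σ.1 r.1 = .horizontal}.ncard := by
  unfold pairedHorizontal
  have hinj : Function.Injective
      fun r : E.Representative => ({r.1, E.mirrorCrossing r.1} : Set E.Crossing) := by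
    intro r r' h
    simp only at h
    have h1 : r.1 ∈ ({r'.1, E.mirrorCrossing r'.1} : Set E.Crossing) := by
      have : r.1 ∈ ({r.1, E.mirrorCrossing r.1} : Set E.Crossing) := by simp
      rwa [h] at this
    rcases h1 with h1 | h1
    · exact Subtype.ext h1
    · have h2 : r.1 = E.mirrorCrossing r'.1 := h1
      have := mirrorCrossing_eq_of_isRepresentative r'.2 (h2 ▸ r.2)
      exact Subtype.ext (h2.trans this)
  rw [← Set.ncard_image_of_injective _ hinj]
  congr 1
  ext P
  constructor
  · rintro ⟨q, h1, h2, rfl⟩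
    rcases isRepresentative_or q with h | h
    · exact ⟨⟨q, h⟩, ⟨h1, h2⟩, rfl⟩
    · refine ⟨⟨_, h⟩, ⟨fun h' => h1 (isUnpaired_mirrorCrossing_iff.1 h'), ?_⟩, ?_⟩
      · exact (σ.2 q).trans h2
      · simp only [E.mirrorCrossing_mirrorCrossing]
        exact Set.pair_comm _ _
  · rintro ⟨r, h, rfl⟩
    exact ⟨r.1, h.1, h.2, rfl⟩

theorem prod_ite_neg_one {ι : Type*} [Fintype ι] (p : ι → Prop) [DecidablePred p] :
    ∏ i, (if p i then (-1 : ℤ) else 1) = (-1) ^ {i | p i}.ncard := by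
  rw [Finset.prod_ite, Finset.prod_const, Finset.prod_const_one, mul_one, ← Set.ncard_coe_finset]
  simp

theorem sign_eq_prod (σ : E.Uncrossing) :
    (-1 : ℤ) ^ (unpairedVertical σ + pairedHorizontal σ) =
      ∏ r : E.Representative, localSign r.1 (σ.1 r.1) := by
  classical
  rw [pow_add, unpairedVertical_eq, pairedHorizontal_eq, ← prod_ite_neg_one, ← prod_ite_neg_one,
    ← Finset.prod_mul_distrib]
  refine Finset.prod_congr rfl fun r _ => ?_
  unfold localSign
  by_cases h : E.IsUnpaired r.1 <;> simp [h]

/-- The resolution `s` of the crossing `q` is consistent with the coloring `c`. -/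
def Allows (q : E.Crossing) (c : E.Segment → ZMod 2) (s : Resolution) : Prop :=
  ∀ i k t (h : E.MeetAt i k t), E.crossing h = q →
    s.Joins (c (E.segL i t) + E.checkerboard (E.segL i t))
      (c (E.segL k t) + E.checkerboard (E.segL k t))
      (c (E.segR i t) + E.checkerboard (E.segR i t))
      (c (E.segR k t) + E.checkerboard (E.segR k t))

theorem Resolution.Joins.flip {s : Resolution} {a b c d : ZMod 2} (h : s.Joins a b c d) :
    s.Joins c d a b := by
  cases s with
  | vertical => exact ⟨h.2, h.1⟩
  | horizontal => exact ⟨h.2.symm, h.1.symm⟩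

theorem Resolution.Joins.swap {s : Resolution} {a b c d : ZMod 2} (h : s.Joins a b c d) :
    s.Joins b a d c := by
  cases s with
  | vertical => exact ⟨h.1.symm, h.2.symm⟩
  | horizontal => exact ⟨h.2, h.1⟩

/-- The reflection exchanges left and right halves, and each resolution is symmetric under this
exchange. -/
theorem Allows.mirror {I : Finset (Fin N)} {c : E.Segment → ZMod 2} (hc : E.IsColoring I c)
    {q : E.Crossing} {s : Resolution} (h : Allows q c s) : Allows (E.mirrorCrossing q) c s := by
  intro i k t hm e
  have := h _ _ _ (E.meetAt_mirror hm)
    ((E.mirrorCrossing_crossing hm).symm.trans (by rw [e, E.mirrorCrossing_mirrorCrossing]))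
  have hL := Ioo_subset_Ioc_self hm.mem_Ioo
  have hR := Ioo_subset_Ico_self hm.mem_Ioo
  simp only [← E.mirrorSegment_segL _ hL, ← E.mirrorSegment_segR _ hR, hc.mirror,
    E.checkerboard_mirrorSegment] at this
  exact this.flip

theorem isConsistent_iff {I : Finset (Fin N)} {c : E.Segment → ZMod 2} (hc : E.IsColoring I c)
    (σ : E.Uncrossing) :
    E.IsConsistent σ c ↔ ∀ r : E.Representative, Allows r.1 c (σ.1 r.1) := by
  rw [IsConsistent, strandInvariant_iff]
  constructor
  · intro h r i k t hm e
    rw [← e]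
    exact h i k t hm
  · intro h i k t hm
    have : Allows (E.crossing hm) c (σ.1 (E.crossing hm)) := by
      rcases isRepresentative_or (E.crossing hm) with h' | h'
      · exact h ⟨_, h'⟩
      · have := (h ⟨_, h'⟩).mirror hc
        rwa [E.mirrorCrossing_mirrorCrossing, σ.2] at this
    exact this i k t hm rfl

open Classical in
/-- The sum of the signs of the resolutions of a crossing that are consistent with `c`. -/
def localWeight (q : E.Crossing) (c : E.Segment → ZMod 2) : ℤ :=
  ∑ s, if Allows q c s then localSign q s else 0

-- Uncrossings are independent choices at the representatives, and both sign and consistency are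
-- tested there one by one, so the sum of products is a product of sums.
open Classical in
theorem sum_sign_consistent {I : Finset (Fin N)} {c : E.Segment → ZMod 2}
    (hc : E.IsColoring I c) :
    ∑ σ : E.Uncrossing with E.IsConsistent σ c,
      (-1 : ℤ) ^ (unpairedVertical σ + pairedHorizontal σ) =
      ∏ r : E.Representative, localWeight r.1 c := by
  simp only [localWeight]
  rw [Finset.prod_univ_sum, Fintype.piFinset_univ, Finset.sum_filter]
  refine Fintype.sum_equiv E.uncrossingEquiv _ _ fun σ => ?_
  rw [Finset.prod_ite_zero, sign_eq_prod]
  simp only [isConsistent_iff hc, Finset.mem_univ, true_imp_iff]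
  rfl

theorem allows_crossing_iff {i k : Fin N} {t : ℝ} (h : E.MeetAt i k t)
    (c : E.Segment → ZMod 2) (s : Resolution) :
    Allows (E.crossing h) c s ↔
      s.Joins (c (E.segL i t) + E.checkerboard (E.segL i t))
        (c (E.segL k t) + E.checkerboard (E.segL k t))
        (c (E.segR i t) + E.checkerboard (E.segR i t))
        (c (E.segR k t) + E.checkerboard (E.segR k t)) := by
  constructor
  · intro h'
    exact h' i k t h rfl
  · intro h' i' k' t' hm e
    rcases Sym2.eq_iff.1 (congrArg Subtype.val e) with ⟨rfl, rfl⟩ | ⟨rfl, rfl⟩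
    · obtain rfl := h.eq_abscissa hm
      exact h'
    · obtain rfl := h.symm.eq_abscissa hm
      exact h'.swap

-- By the checkerboard relations, vertical is consistent when the two left colors differ and the two
-- right colors differ; horizontal when each edge's left color equals the other's right color. Both
-- hold when distinct colors are exchanged, and the signs then cancel. At an unpaired crossing
-- symmetry forces the exchange, so only equal colors survive, with the sign `+1` of the horizontal
-- resolution.
open Classical in
theorem localWeight_crossing {I : Finset (Fin N)} {c : E.Segment → ZMod 2}
    (hc : E.IsColoring I c) {i k : Fin N} {t : ℝ} (h : E.MeetAt i k t) :
    localWeight (E.crossing h) c =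
      if c (E.segL i t) = c (E.segR i t) ∧ c (E.segL k t) = c (E.segR k t) then
        (if ¬ E.IsUnpaired (E.crossing h) ∧ c (E.segL i t) = c (E.segL k t) then -1 else 1)
      else 0 := by
  obtain ⟨h1, h2, h3, h4⟩ := h.checkerboard
  rw [localWeight, Resolution.sum_univ]
  simp only [allows_crossing_iff, Resolution.Joins, localSign, reduceCtorEq, if_true, if_false]
  by_cases hu : E.IsUnpaired (E.crossing h)
  · obtain rfl := (isUnpaired_crossing_iff h).1 hu
    -- The crossing is on the axis, so reflection takes the left half of one edge to the right half
    -- of the other.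
    obtain rfl := h.eq_abscissa (E.meetAt_partner i)
    have e1 : c (E.segR i 0) = c (E.segL (π i) 0) := by
      have := E.mirrorSegment_segL (π i) (t := 0) (by simp)
      rw [π.2.1 i, neg_zero] at this
      rw [← this, hc.mirror]
    have e2 : c (E.segR (π i) 0) = c (E.segL i 0) := by
      have := E.mirrorSegment_segL i (t := 0) (by simp)
      rw [neg_zero] at this
      rw [← this, hc.mirror]
    rw [← h4, ← h3, e1, e2]
    simp only [hu, if_true, not_true, false_and, if_false]
    generalize E.checkerboard (E.segL i 0) = x at *
    generalize E.checkerboard (E.segL (π i) 0) = y at *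
    generalize c (E.segL i 0) = a
    generalize c (E.segL (π i) 0) = b
    clear e1 e2 h2 h3 h4
    revert x y a b
    decide
  · simp only [hu, if_false, not_false_iff, true_and]
    rw [← h4, ← h3]
    generalize E.checkerboard (E.segL i t) = x at *
    generalize E.checkerboard (E.segL k t) = y at *
    generalize c (E.segL i t) = a
    generalize c (E.segL k t) = b
    generalize c (E.segR i t) = a'
    generalize c (E.segR k t) = b'
    clear h2 h3 h4
    revert x y a b a' b'
    decide

end NiceEmbedding

namespace NiceEmbedding

variable {N : ℕ} {π : Matching (Fin N)} {E : NiceEmbedding π}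

/-! ### Colorings that are constant along the edges -/

theorem eq_endSegment_of_continuing {c : E.Segment → ZMod 2}
    (hc : ∀ i k t, E.MeetAt i k t → c (E.segL i t) = c (E.segR i t)) (S : E.Segment) :
    c S = c (E.endSegment (Sum.inl S.edge)) ∧ c S = c (E.endSegment (Sum.inr (π S.edge))) := by
  have hconst : ∀ s ∈ Ioo (-1 : ℝ) 1, c (E.segR S.edge s) = c S := by
    intro s hs
    have hm : (S.left + S.right) / 2 ∈ Ioo (-1 : ℝ) 1 :=
      ⟨S.neg_one_le_left.trans_lt S.midpoint_mem.1, S.midpoint_mem.2.trans_le S.right_le_one⟩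
    have hloc : ∀ t ∈ Ioo (-1 : ℝ) 1,
        ∀ᶠ s in 𝓝 t, c (E.segR S.edge s) = c (E.segR S.edge t) := by
      intro t ht
      have hLR : c (E.segL S.edge t) = c (E.segR S.edge t) := by
        by_cases hb : E.IsBreak S.edge t
        · rcases hb with e | e | ⟨k, hk⟩
          · exact absurd e ht.1.ne'
          · exact absurd e ht.2.ne
          · exact hc _ _ _ hk
        · rw [E.segL_eq_segR ht hb]
      refine eventually_nhds_of_sides ?_ rfl ?_
      · filter_upwards [E.eventually_segR_left S.edge (Ioo_subset_Ioc_self ht)] with s hs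
        rw [hs, hLR]
      · filter_upwards [E.eventually_segR_right S.edge (Ioo_subset_Ico_self ht)] with s hs
        rw [hs]
    rw [eq_of_eventually_eq_nhds (f := fun s => c (E.segR S.edge s)) hloc hs hm, S.segR_eq S.midpoint_mem.1.le S.midpoint_mem.2]
  constructor
  · obtain ⟨s, h1, h2⟩ := ((E.eventually_segR_right S.edge (t := -1) (by simp)).and
      (Ioo_mem_nhdsGT (show (-1 : ℝ) < 1 by norm_num))).exists
    rw [endSegment, ← h1, hconst s h2]
  · obtain ⟨s, h1, h2⟩ := ((E.eventually_segR_left S.edge (t := 1) (by simp)).and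
      (Ioo_mem_nhdsLT (show (-1 : ℝ) < 1 by norm_num))).exists
    rw [endSegment, π.2.1, ← h1, hconst s h2]

theorem continuing_of_prod_ne_zero {I : Finset (Fin N)} {c : E.Segment → ZMod 2}
    (hc : E.IsColoring I c) (h0 : ∏ r : E.Representative, localWeight r.1 c ≠ 0) (i k : Fin N)
    (t : ℝ) (h : E.MeetAt i k t) : c (E.segL i t) = c (E.segR i t) := by
  rw [Finset.prod_ne_zero_iff] at h0
  have key : ∀ i k t (h : E.MeetAt i k t), IsRepresentative (E.crossing h) →
      c (E.segL i t) = c (E.segR i t) := by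
    intro i k t h hr
    have := h0 ⟨_, hr⟩ (Finset.mem_univ _)
    rw [localWeight_crossing hc h, ite_ne_right_iff] at this
    exact this.1.1
  rcases isRepresentative_or (E.crossing h) with hr | hr
  · exact key _ _ _ _ hr
  · have := key _ _ _ (E.meetAt_mirror h) hr
    rw [← E.mirrorSegment_segR _ (Ioo_subset_Ico_self h.mem_Ioo),
      ← E.mirrorSegment_segL _ (Ioo_subset_Ioc_self h.mem_Ioo), hc.mirror, hc.mirror] at this
    exact this.symm

/-- The two edges that cross at `q` start on the same side of the partition `I`, `Iᶜ`. -/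
def SameSide (I : Finset (Fin N)) (q : E.Crossing) : Prop :=
  ∀ i k, q.1 = s(i, k) → (i ∈ I ↔ k ∈ I)

theorem sameSide_crossing_iff {I : Finset (Fin N)} {i k : Fin N} {t : ℝ} (h : E.MeetAt i k t) :
    SameSide I (E.crossing h) ↔ (i ∈ I ↔ k ∈ I) := by
  constructor
  · intro h'
    exact h' i k rfl
  · intro h' i' k' e
    rcases Sym2.eq_iff.1 e with ⟨rfl, rfl⟩ | ⟨rfl, rfl⟩
    · exact h'
    · exact h'.symm

instance : Fintype E.Segment := Fintype.ofFinite _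

-- A coloring with nonzero product is constant on each edge. The edge `i` has the color of `i` at
-- its left end and of `π i` at its right end, so `π` preserves `I` and the coloring is determined.
open Classical in
theorem sum_prod_localWeight (E : NiceEmbedding π) (I : Finset (Fin N)) :
    ∑ c with E.IsColoring I c, ∏ r : E.Representative, localWeight r.1 c =
      if ∀ i, i ∈ I ↔ π i ∈ I then
        (-1) ^ {r : E.Representative | ¬ E.IsUnpaired r.1 ∧ SameSide I r.1}.ncard else 0 := by
  have hedge : ∀ c, E.IsColoring I c → ∏ r : E.Representative, localWeight r.1 c ≠ 0 →
      (∀ S, c S = if S.edge ∈ I then 1 else 0) ∧ ∀ i, i ∈ I ↔ π i ∈ I := by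
    intro c hc h0
    have h := eq_endSegment_of_continuing (continuing_of_prod_ne_zero hc h0)
    refine ⟨fun S => (h S).1.trans (hc.boundary _), fun i => ?_⟩
    have h1 := (h (E.segR i 0)).1.symm.trans (h (E.segR i 0)).2
    rw [hc.boundary, hc.boundary, segR_edge] at h1
    simp only [boundaryLabel] at h1
    by_cases hi : i ∈ I <;> by_cases hi' : π i ∈ I <;> simp [hi, hi'] at h1 ⊢
  split_ifs with hI
  · set c : E.Segment → ZMod 2 := fun S => if S.edge ∈ I then 1 else 0 with hcdef
    have hc : E.IsColoring I c := by
      refine ⟨fun S => ?_, ?_⟩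
      · simp only [hcdef, mirrorSegment, ← hI]
      · rintro (i | i)
        · simp [hcdef, endSegment, boundaryLabel]
        · simp [hcdef, endSegment, boundaryLabel, ← hI]
    rw [Finset.sum_eq_single c]
    · rw [← prod_ite_neg_one]
      refine Finset.prod_congr rfl fun r _ => ?_
      obtain ⟨i, k, t, h, e⟩ := exists_eq_crossing r.1
      rw [e, localWeight_crossing hc h, sameSide_crossing_iff]
      have : c (E.segL i t) = c (E.segL k t) ↔ (i ∈ I ↔ k ∈ I) := by
        simp only [hcdef, segL_edge]
        by_cases hi : i ∈ I <;> by_cases hk : k ∈ I <;> simp [hi, hk]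
      simp only [this]
      simp only [hcdef, segL_edge, segR_edge, and_self, if_true]
      split_ifs <;> rfl
    · intro c' hc' hne
      by_contra h0
      exact hne (funext (hedge c' (by simpa using hc') h0).1)
    · intro h
      exact absurd (by simpa using hc) h
  · refine Finset.sum_eq_zero fun c hc => ?_
    by_contra h0
    exact hI (hedge c (by simpa using hc) h0).2

open Classical in
theorem sum_weight_compatible (E : NiceEmbedding π) (I : Finset (Fin N)) :
    ∑ σ : E.Uncrossing, (if IsCompatible I (diagram σ) then weight σ else 0) =
      if ∀ i, i ∈ I ↔ π i ∈ I then
        (-1) ^ {r : E.Representative | ¬ E.IsUnpaired r.1 ∧ SameSide I r.1}.ncard else 0 := by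
  rw [← sum_prod_localWeight]
  have h1 : ∀ σ : E.Uncrossing, (if IsCompatible I (diagram σ) then weight σ else 0) =
      ∑ c with E.IsColoring I c, if E.IsConsistent σ c then
        (-1 : ℤ) ^ (unpairedVertical σ + pairedHorizontal σ) else 0 := by
    intro σ
    rw [← Finset.sum_filter, Finset.filter_filter, Finset.sum_const, ← Set.ncard_coe_finset]
    have := ncard_colorings σ I
    simp only [Finset.coe_filter, Finset.mem_univ, true_and]
    rw [this]
    split_ifs <;> simp [weight]
  rw [Finset.sum_congr rfl fun σ _ => h1 σ, Finset.sum_comm]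
  refine Finset.sum_congr rfl fun c hc => ?_
  rw [← sum_sign_consistent (I := I) (by simpa using hc), Finset.sum_filter]

/-! ### Counting the crossings between edges of the same color -/

/-- The height difference changes sign at a meeting and vanishes nowhere else, so meeting edges
arrive in reversed order; the converse is the intermediate value theorem. -/
theorem exists_meetAt_iff {i j : Fin N} (hij : i < j) : (∃ t, E.MeetAt i j t) ↔ π j < π i := by
  set δ : ℝ → ℝ := fun t => E.curve i t - E.curve j t with hδ
  have hcont : ContinuousOn δ (Icc (-1) 1) :=
    (E.continuousOn_curve i).sub (E.continuousOn_curve j)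
  have hl : 0 < δ (-1) := by
    simp only [hδ, E.curve_left]
    exact sub_pos.2 (E.height_strictAnti hij)
  have hmeet : ∀ t ∈ Icc (-1 : ℝ) 1, δ t = 0 → E.MeetAt i j t := fun t ht h =>
    ⟨hij.ne, ht, sub_eq_zero.1 h⟩
  constructor
  · rintro ⟨t, h⟩
    by_contra hπ
    have hr : 0 < δ 1 := by
      simp only [hδ, E.curve_right]
      refine sub_pos.2 (E.height_strictAnti (lt_of_le_of_ne (not_lt.1 hπ) fun e => ?_))
      exact hij.ne (π.2.1.injective e)
    have ht := h.mem_Ioo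
    obtain ⟨s, h1, h2⟩ := ((E.no_tangency i j h.1 t h.2.1 h.2.2).and
      (Ioo_mem_nhdsLT ht.1)).exists
    obtain ⟨u, h3, h4⟩ := (h1.and (Ioo_mem_nhdsGT ht.2)).exists
    -- A nonpositive value here would give a second meeting, to the left of `t`.
    have hs : 0 < δ s := by
      by_contra hs
      obtain ⟨z, hz, hz0⟩ := intermediate_value_Icc' h2.1.le
        (hcont.mono (Icc_subset_Icc_right (h2.2.le.trans ht.2.le))) ⟨not_lt.1 hs, hl.le⟩
      have := h.eq_abscissa (hmeet z ⟨hz.1, hz.2.trans (h2.2.le.trans ht.2.le)⟩ hz0)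
      linarith [hz.2, h2.2]
    have hu : 0 < δ u := by
      by_contra hu
      obtain ⟨z, hz, hz0⟩ := intermediate_value_Icc h4.2.le
        (hcont.mono (Icc_subset_Icc_left (ht.1.le.trans h4.1.le))) ⟨not_lt.1 hu, hr.le⟩
      have := h.eq_abscissa (hmeet z ⟨(ht.1.le.trans h4.1.le).trans hz.1, hz.2⟩ hz0)
      linarith [hz.1, h4.1]
    exact (mul_pos hs hu).not_gt h3
  · intro hπ
    have hr : δ 1 < 0 := by
      simp only [hδ, E.curve_right]
      exact sub_neg.2 (E.height_strictAnti hπ)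
    obtain ⟨z, hz, hz0⟩ := intermediate_value_Icc' (by norm_num) hcont ⟨hr.le, hl.le⟩
    exact ⟨z, hmeet z hz hz0⟩

/-- For `i < k`, the crossing of `i` and `k` is a representative when `i` is the least of `i`, `k`,
`π i`, `π k`; the strict inequality `i < π k` excludes unpaired crossings. -/
theorem ncard_sameSide (E : NiceEmbedding π) (I : Finset (Fin N)) :
    {r : E.Representative | ¬ E.IsUnpaired r.1 ∧ SameSide I r.1}.ncard =
      {p : Fin N × Fin N | p.1 < p.2 ∧ p.1 < π p.1 ∧ p.1 < π p.2 ∧ π p.2 < π p.1 ∧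
        (p.1 ∈ I ↔ p.2 ∈ I)}.ncard := by
  have hinj : Function.Injective fun r : E.Representative => r.1.1 :=
    Subtype.val_injective.comp Subtype.val_injective
  have hinj' : Set.InjOn (fun p : Fin N × Fin N => s(p.1, p.2))
      {p : Fin N × Fin N | p.1 < p.2 ∧ p.1 < π p.1 ∧ p.1 < π p.2 ∧ π p.2 < π p.1 ∧
        (p.1 ∈ I ↔ p.2 ∈ I)} := by
    rintro ⟨i, j⟩ h ⟨i', j'⟩ h' e
    rcases Sym2.eq_iff.1 e with ⟨rfl, rfl⟩ | ⟨rfl, rfl⟩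
    · rfl
    · exact absurd h.1 h'.1.not_gt
  rw [← Set.ncard_image_of_injective _ hinj, ← hinj'.ncard_image]
  congr 1
  have key : ∀ i k t (h : E.MeetAt i k t), i < k → IsRepresentative (E.crossing h) →
      ¬ E.IsUnpaired (E.crossing h) → i < π i ∧ i < π k ∧ π k < π i := by
    intro i k t h hik hr hu
    rw [isUnpaired_crossing_iff] at hu
    unfold IsRepresentative at hr
    simp only [mirrorCrossing, crossing, Sym2.map_mk, Sym2.inf_mk, min_eq_left hik.le,
      le_min_iff] at hr
    refine ⟨lt_of_le_of_ne hr.1 (π.2.2 i).symm, lt_of_le_of_ne hr.2 fun e => hu ?_,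
      (exists_meetAt_iff hik).1 ⟨t, h⟩⟩
    rw [e, π.2.1]
  ext e
  constructor
  · rintro ⟨⟨q, hr⟩, ⟨hu, hs⟩, rfl⟩
    obtain ⟨i, k, t, h, rfl⟩ := exists_eq_crossing q
    rw [sameSide_crossing_iff] at hs
    rcases lt_or_gt_of_ne h.1 with hik | hik
    · obtain ⟨h1, h2, h3⟩ := key i k t h hik hr hu
      exact ⟨(i, k), ⟨hik, h1, h2, h3, hs⟩, rfl⟩
    · obtain ⟨h1, h2, h3⟩ := key k i t h.symm hik (by rwa [E.crossing_symm h])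
        (by rwa [E.crossing_symm h])
      exact ⟨(k, i), ⟨hik, h1, h2, h3, hs.symm⟩, Sym2.eq_swap⟩
  · rintro ⟨⟨i, k⟩, ⟨hik, h1, h2, h3, hs⟩, rfl⟩
    simp only at hik h1 h2 h3 hs
    obtain ⟨t, h⟩ := (exists_meetAt_iff (E := E) hik).2 h3
    refine ⟨⟨E.crossing h, ?_⟩, ⟨?_, (sameSide_crossing_iff h).2 hs⟩, rfl⟩
    · unfold IsRepresentative
      simp only [mirrorCrossing, crossing, Sym2.map_mk, Sym2.inf_mk, min_eq_left hik.le,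
        le_min_iff]
      exact ⟨h1.le, h2.le⟩
    · rw [isUnpaired_crossing_iff]
      rintro rfl
      rw [π.2.1] at h2
      exact lt_irrefl _ h2

end NiceEmbedding

/-- The crossings of the arc diagram of `π` between arcs on the same side of the partition `I`,
`Iᶜ`, counted modulo two by the pairs of edges of `ν π` that cross. -/
theorem neg_one_pow_ncard_crossings {N : ℕ} (π : Matching (Fin N)) (I : Finset (Fin N))
    (hI : ∀ i, i ∈ I ↔ π i ∈ I) :
    (-1 : ℤ) ^ {p : Fin N × Fin N | p.1 < p.2 ∧ p.1 < π p.1 ∧ p.1 < π p.2 ∧ π p.2 < π p.1 ∧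
        (p.1 ∈ I ↔ p.2 ∈ I)}.ncard =
      (-1) ^ {p : Fin N × Fin N | (p.1 < p.2 ∧ p.2 < π p.1 ∧ π p.1 < π p.2) ∧
        (p.1 ∈ I ↔ p.2 ∈ I)}.ncard := by
  set X := {p : Fin N × Fin N | (p.1 < p.2 ∧ p.2 < π p.1 ∧ π p.1 < π p.2) ∧
        (p.1 ∈ I ↔ p.2 ∈ I)} with hX
  -- `A` lists the nested pairs of arcs by their left ends; in `B` the second arc is named by its
  -- right end. Renaming it by its left end carries `B` to `A ∪ X`, so nested pairs are counted
  -- twice and crossing pairs once.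
  set A := {p : Fin N × Fin N | p.1 < p.2 ∧ p.2 < π p.2 ∧ π p.2 < π p.1 ∧
        (p.1 ∈ I ↔ p.2 ∈ I)} with hA
  set B := {p : Fin N × Fin N | p.1 < π p.2 ∧ π p.2 < p.2 ∧ π p.2 < π p.1 ∧
        (p.1 ∈ I ↔ p.2 ∈ I)} with hB
  have hinj : Function.Injective fun p : Fin N × Fin N => (p.1, π p.2) := by
    rintro ⟨i, j⟩ ⟨i', j'⟩ e
    simp only [Prod.mk.injEq] at e
    rw [e.1, π.2.1.injective e.2]
  have hM : {p : Fin N × Fin N | p.1 < p.2 ∧ p.1 < π p.1 ∧ p.1 < π p.2 ∧ π p.2 < π p.1 ∧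
        (p.1 ∈ I ↔ p.2 ∈ I)} = A ∪ B := by
    ext ⟨i, j⟩
    have := π.2.2 j
    simp only [hA, hB, Set.mem_union, Set.mem_ofPred_eq]
    constructor
    · rintro ⟨h1, h2, h3, h4, h5⟩
      rcases lt_or_gt_of_ne this with h | h
      · exact Or.inr ⟨h3, h, h4, h5⟩
      · exact Or.inl ⟨h1, h, h4, h5⟩
    · rintro (⟨h1, h2, h3, h4⟩ | ⟨h1, h2, h3, h4⟩)
      · exact ⟨h1, h1.trans (h2.trans h3), h1.trans h2, h3, h4⟩
      · exact ⟨h1.trans h2, h1.trans h3, h1, h3, h4⟩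
  have hBim : (fun p : Fin N × Fin N => (p.1, π p.2)) '' B = A ∪ X := by
    ext ⟨i, k⟩
    simp only [hA, hB, hX, Set.mem_image, Set.mem_union, Set.mem_ofPred_eq]
    constructor
    · rintro ⟨⟨i', j⟩, ⟨h1, h2, h3, h4⟩, e⟩
      simp only [Prod.mk.injEq] at h1 h2 h3 h4 e
      obtain ⟨rfl, rfl⟩ := e
      rw [π.2.1, ← hI j]
      have hne : j ≠ π i' := fun e => by rw [e, π.2.1] at h1; exact lt_irrefl _ h1
      rcases lt_or_gt_of_ne hne with h | h
      · exact Or.inl ⟨h1, h2, h, h4⟩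
      · exact Or.inr ⟨⟨h1, h3, h⟩, h4⟩
    · intro h
      refine ⟨(i, π k), ?_, by simp [π.2.1 k]⟩
      simp only [π.2.1 k, ← hI k]
      rcases h with ⟨h1, h2, h3, h4⟩ | ⟨⟨h1, h2, h3⟩, h4⟩
      · exact ⟨h1, h2, h2.trans h3, h4⟩
      · exact ⟨h1, h2.trans h3, h2, h4⟩
  have hAB : Disjoint A B := Set.disjoint_left.2 fun p h h' => h.2.1.not_gt h'.2.1
  have hAX : Disjoint A X := Set.disjoint_left.2 fun p h h' => h.2.2.1.not_gt h'.1.2.2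
  rw [hM, Set.ncard_union_eq hAB (Set.toFinite _) (Set.toFinite _),
    ← Set.ncard_image_of_injective B hinj, hBim,
    Set.ncard_union_eq hAX (Set.toFinite _) (Set.toFinite _), ← add_assoc, pow_add,
    ← two_mul, pow_mul]
  simp

/-! ### Products of pfaffians -/

section Glue

variable {V : Type*} [Fintype V] [LinearOrder V] (I : Finset V)

/-- The union of a matching of `I` and a matching of its complement. -/
def glueFun (p : Matching I × Matching (Iᶜ : Finset V)) (v : V) : V :=
  if h : v ∈ I then (p.1 ⟨v, h⟩ : V) else (p.2 ⟨v, Finset.mem_compl.2 h⟩ : V)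

theorem glueFun_left (p : Matching I × Matching (Iᶜ : Finset V)) (v : I) :
    glueFun I p v = p.1 v := by
  rw [glueFun, dif_pos v.2]

theorem glueFun_right (p : Matching I × Matching (Iᶜ : Finset V)) (v : (Iᶜ : Finset V)) :
    glueFun I p v = p.2 v := by
  rw [glueFun, dif_neg (Finset.mem_compl.1 v.2)]

theorem forall_mem_or_compl {P : V → Prop} (h1 : ∀ v : I, P v) (h2 : ∀ v : (Iᶜ : Finset V), P v)
    (v : V) : P v := by
  by_cases h : v ∈ I
  · exact h1 ⟨v, h⟩
  · exact h2 ⟨v, Finset.mem_compl.2 h⟩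

/-- Pairs of matchings of `I` and of its complement are the matchings that preserve `I`. -/
def glueEquiv : Matching I × Matching (Iᶜ : Finset V) ≃
    {π : Matching V // ∀ i, i ∈ I ↔ π i ∈ I} where
  toFun p := ⟨⟨glueFun I p,
      forall_mem_or_compl I (fun v => by rw [glueFun_left, glueFun_left, p.1.2.1])
        (fun v => by rw [glueFun_right, glueFun_right, p.2.2.1]),
      forall_mem_or_compl I (fun v => by
        rw [glueFun_left]; exact fun e => p.1.2.2 v (Subtype.ext e))
        (fun v => by rw [glueFun_right]; exact fun e => p.2.2.2 v (Subtype.ext e))⟩,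
    forall_mem_or_compl I
      (fun v => iff_of_true v.2 (by
        change glueFun I p v ∈ I
        rw [glueFun_left]; exact (p.1 v).2))
      (fun v => iff_of_false (Finset.mem_compl.1 v.2) (by
        change glueFun I p v ∉ I
        rw [glueFun_right]; exact Finset.mem_compl.1 (p.2 v).2))⟩
  invFun π := (⟨fun v => ⟨π.1 v, (π.2 v).1 v.2⟩, fun v => Subtype.ext (π.1.2.1 v),
      fun v e => π.1.2.2 v (congrArg Subtype.val e)⟩,
    ⟨fun v => ⟨π.1 v, Finset.mem_compl.2 fun h => Finset.mem_compl.1 v.2 ((π.2 v).2 h)⟩,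
      fun v => Subtype.ext (π.1.2.1 v), fun v e => π.1.2.2 v (congrArg Subtype.val e)⟩)
  left_inv p := Prod.ext
    (Subtype.ext (funext fun v => Subtype.ext (glueFun_left I p v)))
    (Subtype.ext (funext fun v => Subtype.ext (glueFun_right I p v)))
  right_inv π := Subtype.ext (Subtype.ext (funext (forall_mem_or_compl I
    (fun v => glueFun_left I _ v) (fun v => glueFun_right I _ v))))

variable {I}

theorem glueEquiv_left (p : Matching I × Matching (Iᶜ : Finset V)) (v : I) :
    (glueEquiv I p).1 v = p.1 v := glueFun_left I p v

theorem glueEquiv_right (p : Matching I × Matching (Iᶜ : Finset V)) (v : (Iᶜ : Finset V)) :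
    (glueEquiv I p).1 v = p.2 v := glueFun_right I p v

theorem crossingNumber_add_crossingNumber (p : Matching I × Matching (Iᶜ : Finset V)) :
    crossingNumber p.1 + crossingNumber p.2 =
      {q : V × V | (q.1 < q.2 ∧ q.2 < (glueEquiv I p).1 q.1 ∧
        (glueEquiv I p).1 q.1 < (glueEquiv I p).1 q.2) ∧ (q.1 ∈ I ↔ q.2 ∈ I)}.ncard := by
  have hinj : ∀ J : Finset V, Function.Injective
      (Prod.map (Subtype.val : J → V) (Subtype.val : J → V)) := fun J =>
    Subtype.val_injective.prodMap Subtype.val_injective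
  rw [crossingNumber, crossingNumber, ← Set.ncard_image_of_injective _ (hinj I),
    ← Set.ncard_image_of_injective _ (hinj Iᶜ), ← Set.ncard_union_eq]
  · congr 1
    ext ⟨v, w⟩
    constructor
    · rintro (⟨⟨v', w'⟩, h, e⟩ | ⟨⟨v', w'⟩, h, e⟩) <;>
        obtain ⟨rfl, rfl⟩ := Prod.mk.inj e
      · refine ⟨?_, iff_of_true v'.2 w'.2⟩
        simp only [glueEquiv_left]
        exact h
      · refine ⟨?_, iff_of_false (Finset.mem_compl.1 v'.2) (Finset.mem_compl.1 w'.2)⟩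
        simp only [glueEquiv_right]
        exact h
    · rintro ⟨h, hI⟩
      simp only at h hI
      by_cases hv : v ∈ I
      · have h1 := glueEquiv_left p ⟨v, hv⟩
        have h2 := glueEquiv_left p ⟨w, hI.1 hv⟩
        simp only at h1 h2
        rw [h1, h2] at h
        exact Or.inl ⟨(⟨v, hv⟩, ⟨w, hI.1 hv⟩), h, rfl⟩
      · have hw : w ∉ I := fun hw => hv (hI.2 hw)
        have h1 := glueEquiv_right p ⟨v, Finset.mem_compl.2 hv⟩
        have h2 := glueEquiv_right p ⟨w, Finset.mem_compl.2 hw⟩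
        simp only at h1 h2
        rw [h1, h2] at h
        exact Or.inr ⟨(⟨v, Finset.mem_compl.2 hv⟩, ⟨w, Finset.mem_compl.2 hw⟩), h, rfl⟩
  · rw [Set.disjoint_left]
    rintro _ ⟨⟨v, w⟩, -, rfl⟩ ⟨⟨v', w'⟩, -, e⟩
    have := (Prod.mk.inj e).1
    exact Finset.mem_compl.1 v'.2 (this ▸ v.2)

theorem monomial_mul_monomial {R : Type*} [CommRing R] (A : Matrix V V R)
    (p : Matching I × Matching (Iᶜ : Finset V)) :
    monomial (A.submatrix (Subtype.val : I → V) Subtype.val) p.1 *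
      monomial (A.submatrix (Subtype.val : (Iᶜ : Finset V) → V) Subtype.val) p.2 =
      monomial A (glueEquiv I p).1 := by
  simp only [monomial, Finset.prod_filter]
  rw [← Finset.prod_mul_prod_compl I, ← Finset.prod_coe_sort I, ← Finset.prod_coe_sort Iᶜ]
  congr 1
  · refine Finset.prod_congr rfl fun v _ => ?_
    simp only [glueEquiv_left, Subtype.coe_lt_coe, Matrix.submatrix_apply]
  · refine Finset.prod_congr rfl fun v _ => ?_
    simp only [glueEquiv_right, Subtype.coe_lt_coe, Matrix.submatrix_apply]

-- Pairs of matchings of `I` and `Iᶜ` glue to the matchings preserving `I`; each factor sees only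
-- the crossings within its own side.
open Classical in
theorem complementaryPfaffian_eq {R : Type*} [CommRing R] (A : Matrix V V R) :
    complementaryPfaffian I A = ∑ π : Matching V,
      (if ∀ i, i ∈ I ↔ π i ∈ I then
        (-1) ^ {q : V × V | (q.1 < q.2 ∧ q.2 < π q.1 ∧ π q.1 < π q.2) ∧
          (q.1 ∈ I ↔ q.2 ∈ I)}.ncard else 0) * monomial A π := by
  simp only [ite_mul, zero_mul]
  rw [complementaryPfaffian, pfaffianOn, pfaffianOn, pfaffian, pfaffian, Finset.sum_mul_sum,
    ← Finset.sum_product', Finset.univ_product_univ, ← Finset.sum_filter,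
    Finset.sum_subtype (p := fun π : Matching V => ∀ i, i ∈ I ↔ π i ∈ I) _ (by simp)]
  refine Fintype.sum_equiv (glueEquiv I) _ _ fun p => ?_
  rw [← crossingNumber_add_crossingNumber, ← monomial_mul_monomial, pow_add]
  ring

end Glue

/-! ### Regrouping by diagrams and comparison of coefficients. -/

open Classical in
theorem sum_diagramWeight {n : ℕ} {π : Matching (Fin (2 * n))} (E : NiceEmbedding π)
    (I : Finset (Fin (2 * n))) :
    ∑ D ∈ compatibleDiagrams I, E.diagramWeight D.1 =
      ∑ σ : E.Uncrossing,
        if IsCompatible I (NiceEmbedding.diagram σ) then NiceEmbedding.weight σ else 0 := by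
  simp only [NiceEmbedding.diagramWeight, Finset.sum_filter, NiceEmbedding.hasDiagram_iff]
  rw [Finset.sum_comm]
  refine Finset.sum_congr rfl fun σ _ => ?_
  -- The single symmetric diagram to which `σ` contributes.
  let D₀ : SymTLDiagram n := ⟨NiceEmbedding.diagram σ, NiceEmbedding.isNoncrossing_diagram σ,
    NiceEmbedding.isMirrorSymmetric_diagram σ⟩
  have h : ∀ D : SymTLDiagram n, D.1 = NiceEmbedding.diagram σ ↔ D = D₀ := fun D =>
    ⟨fun e => Subtype.ext e, fun e => congrArg Subtype.val e⟩
  simp only [h, Finset.sum_ite_eq']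
  simp [compatibleDiagrams, D₀]

end TLPfaff

end

theorem mainTheorem2 {R : Type*} [CommRing R] (n : ℕ)
    (A : Matrix (Fin (2 * n)) (Fin (2 * n)) R) (hA : A.transpose = -A)
    (E : ∀ π : TLPfaff.Matching (Fin (2 * n)), TLPfaff.NiceEmbedding π)
    (I : Finset (Fin (2 * n))) (hI : Even I.card) :
    TLPfaff.complementaryPfaffian I A =
      ∑ D ∈ TLPfaff.compatibleDiagrams I, TLPfaff.diagramPfaffinant E D A := by
  classical
  simp only [TLPfaff.diagramPfaffinant, TLPfaff.pfaffinant]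
  rw [Finset.sum_comm, TLPfaff.complementaryPfaffian_eq]
  refine Finset.sum_congr rfl fun π _ => ?_
  rw [← Finset.sum_mul, ← Int.cast_sum, TLPfaff.sum_diagramWeight,
    TLPfaff.NiceEmbedding.sum_weight_compatible]
  congr 1
  split_ifs with h
  · rw [TLPfaff.NiceEmbedding.ncard_sameSide, TLPfaff.neg_one_pow_ncard_crossings π I h]
    push_cast
    rfl
  · simp
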